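/- Let $G=(V,E)$ be a finite graph. An edge $2$-coloring of $G$ is a map $\sigma:E\to\mathbb N$ such that every vertex is incident to edges of at most $2$ different colors; the min-max edge $2$-coloring problem asks for an edge $2$-coloring that minimizes the size $\max_k|\{e\in E:\sigma(e)=k\}|$ of the largest color group. Consider the following algorithm for a tree $T$ on the vertices $0,\dots,n-1$, given by its adjacency matrix, with maximum degree $\Delta$. If $\Delta\le 1$, it returns $m=\Delta$ and gives all edges one color. Otherwise it sets $m\leftarrow\Delta-1$ and does the following for each vertex $r$, taken as the root. * Label every vertex with its distance from $r$ by breadth-first search. Set $l\leftarrow\lceil\Delta/2\rceil$, $u\leftarrow\Delta-1$. Repeat the following test until $l=u$ and a coloring $U$ has been stored for this root. * Test: set $c\leftarrow\lfloor(l+u)/2\rfloor$, erase the current coloring, and give each vertex $v\neq r$ the residual number $v_l\leftarrow 1$ and the root the residual number $0$. Go through the vertices $v$ that have children in descending order of distance from $r$. For each of them, choose by dynamic programming (a table indexed by the number of items and the capacity) a set $S$ of children of $v$ whose residual numbers have the largest possible sum not exceeding $c$, and let $R$ be the sum of the residual numbers of the children outside $S$. If $R+v_l>c$, the test fails: set $l\leftarrow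 c+1$. If not, color all uncolored edges incident to the vertices of $S$ and to their descendants with one new color, and set $v_l\leftarrow v_l+R$. If no vertex makes the test fail, color the remaining uncolored edges with one new color, store the coloring as $U$, and set $u\leftarrow c$. * After the repetition, if $u\le m$, set $m\leftarrow u$ and $M\leftarrow U$. The output is $m$ and the coloring $M$. **Theorem.** There is a polynomial $p$ such that, for every $n$ and every tree $T$ on $n$ vertices, this algorithm, written as an explicit program for a random access machine (registers and arrays of natural numbers; addition, truncated subtraction, halving, comparisons, assignments, branching and while-loops; every elementary command or branching decision counts as one step), halts on input $T$ after at most $p(n)$ steps, and its output is feasible and optimal: $M$ assigns a color to every edge of $T$, it is an edge $2$-coloring, the size of its largest color group is $m$, and no edge $2$-coloring of $T$ has a smaller largest color group. -/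

import Mathlib

/-! ## The min-max edge `q`-coloring problem -/

namespace MinMaxColoring

section Problem

variable {V K : Type*} {G : SimpleGraph V}

/-- The set of colors on the edges incident to the vertex `v`. -/
def colorsAt (χ : G.EdgeLabeling K) (v : V) : Set K :=
  {k | ∃ e : G.edgeSet, v ∈ e.1 ∧ χ e = k}

/-- A feasible solution: at most `q` different colors are incident to each vertex. -/
def IsEdgeQColoring (q : ℕ) (χ : G.EdgeLabeling K) : Prop :=
  ∀ v, (colorsAt χ v).encard ≤ q

/-- The size of a largest color group. -/
noncomputable def largestGroup (χ : G.EdgeLabeling K) : ℕ∞ :=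
  ⨆ k : K, {e : G.edgeSet | χ e = k}.encard

/-- A feasible and optimal solution of the min-max edge `q`-coloring problem on `G`. -/
def IsOptimal (q : ℕ) (χ : G.EdgeLabeling ℕ) : Prop :=
  IsEdgeQColoring q χ ∧
    ∀ χ' : G.EdgeLabeling ℕ, IsEdgeQColoring q χ' → largestGroup χ ≤ largestGroup χ'

end Problem

/-! ## A random access machine with a step count

Finitely many registers and finitely many (two-dimensional, unbounded) arrays hold natural
numbers. The only arithmetic operations are addition, truncated subtraction and halving (no
multiplication), so that unit cost per step is polynomially equivalent to Turing machine time. -/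

section Machine

/-- Arithmetic expressions over register names `R` and array names `A`. -/
inductive Exp (R A : Type) : Type
  | lit (k : ℕ)
  | reg (x : R)
  | cell (a : A) (i j : Exp R A)
  | add (e f : Exp R A)
  | sub (e f : Exp R A)
  | half (e : Exp R A)

/-- Tests that control branching. -/
inductive Test (R A : Type) : Type
  | le (e f : Exp R A)
  | lt (e f : Exp R A)
  | eq (e f : Exp R A)
  | and (b b' : Test R A)
  | not (b : Test R A)

/-- Commands. -/
inductive Cmd (R A : Type) : Type
  | skip
  | set (x : R) (e : Exp R A)
  | put (a : A) (i j e : Exp R A)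
  | seq (p p' : Cmd R A)
  | ite (b : Test R A) (p p' : Cmd R A)
  | loop (b : Test R A) (p : Cmd R A)

/-- Contents of the registers and of the arrays. -/
structure Memory (R A : Type) : Type where
  reg : R → ℕ
  arr : A → ℕ → ℕ → ℕ

variable {R A : Type}

/-- The value of an expression. -/
def Exp.eval (σ : Memory R A) : Exp R A → ℕ
  | .lit k => k
  | .reg x => σ.reg x
  | .cell a i j => σ.arr a (i.eval σ) (j.eval σ)
  | .add e f => e.eval σ + f.eval σ
  | .sub e f => e.eval σ - f.eval σ
  | .half e => e.eval σ / 2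

/-- The outcome of a test. -/
def Test.eval (σ : Memory R A) : Test R A → Bool
  | .le e f => decide (e.eval σ ≤ f.eval σ)
  | .lt e f => decide (e.eval σ < f.eval σ)
  | .eq e f => decide (e.eval σ = f.eval σ)
  | .and b b' => b.eval σ && b'.eval σ
  | .not b => !b.eval σ

/-- Execute the commands of a list one after the other. -/
def block : List (Cmd R A) → Cmd R A
  | [] => .skip
  | p :: l => .seq p (block l)

/-- `if b then l`. -/
def when (b : Test R A) (l : List (Cmd R A)) : Cmd R A :=
  .ite b (block l) .skip

/-- `for x = 0, 1, …, e - 1 do l`. -/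
def forTo (x : R) (e : Exp R A) (l : List (Cmd R A)) : Cmd R A :=
  .seq (.set x (.lit 0))
    (.loop (.lt (.reg x) e) (.seq (block l) (.set x (.add (.reg x) (.lit 1)))))

/-- One-dimensional arrays are stored in row `0`. -/
def Exp.vec (a : A) (i : Exp R A) : Exp R A := .cell a (.lit 0) i

/-- Assignment to a one-dimensional array. -/
def Cmd.putVec (a : A) (i e : Exp R A) : Cmd R A := .put a (.lit 0) i e

instance : Coe R (Exp R A) := ⟨Exp.reg⟩

instance (k : ℕ) : OfNat (Exp R A) k := ⟨Exp.lit k⟩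

variable [DecidableEq R] [DecidableEq A]

/-- Write `k` into the register `x`. -/
def Memory.setReg (σ : Memory R A) (x : R) (k : ℕ) : Memory R A :=
  { σ with reg := Function.update σ.reg x k }

/-- Write `k` into the array cell `a[i][j]`. -/
def Memory.setCell (σ : Memory R A) (a : A) (i j k : ℕ) : Memory R A :=
  { σ with arr :=
      Function.update σ.arr a (Function.update (σ.arr a) i (Function.update (σ.arr a i) j k)) }

/-- One machine step. A configuration consists of the stack of commands that are still to be
executed and of the memory. `loop b p` is the loop "while `b` do `p`". -/
def step : List (Cmd R A) × Memory R A → List (Cmd R A) × Memory R A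
  | ([], σ) => ([], σ)
  | (.skip :: s, σ) => (s, σ)
  | (.set x e :: s, σ) => (s, σ.setReg x (e.eval σ))
  | (.put a i j e :: s, σ) => (s, σ.setCell a (i.eval σ) (j.eval σ) (e.eval σ))
  | (.seq p p' :: s, σ) => (p :: p' :: s, σ)
  | (.ite b p p' :: s, σ) => ((if b.eval σ then p else p') :: s, σ)
  | (.loop b p :: s, σ) => if b.eval σ then (p :: .loop b p :: s, σ) else (s, σ)

/-- Started in memory `σ`, the program `p` has halted after `t` steps with memory `σ'`. -/
def HaltsIn (p : Cmd R A) (σ : Memory R A) (t : ℕ) (σ' : Memory R A) : Prop :=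
  step^[t] ([p], σ) = ([], σ')

end Machine

/-! ## The tree coloring algorithm -/

/-- Registers: `n` is the number of vertices, `Delta` the maximum degree, `m` the best bound found
so far, `root` the current root, `l`, `u` the current search interval, `c` the current candidate,
`ok` is `1` as long as the current candidate has not failed, `stored` is `1` if a coloring has been
stored for the current root, `color` is the last color used. The others are auxiliary. -/
inductive Reg : Type
  | n | Delta | m | root | l | u | c | ok | stored | color
  | d | v | count | total | size | i | j | k | w | x | y
  deriving DecidableEq

/-- Arrays: `adj` is the adjacency matrix, `label` holds the distance from the root plus one
(`0` if not yet known), `res` the residual numbers, `cur` the current coloring (`0` stands for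
uncolored), `U` the last successful coloring for the current root, `M` the best coloring, `child`
lists the children of the current vertex, `opt` is the dynamic programming table of the knapsack
problem, and `mark` marks vertices. -/
inductive Arr : Type
  | adj | label | res | cur | U | M | child | opt | mark
  deriving DecidableEq

section Algorithm

open Reg Arr Exp Test Cmd

local infixl:65 "∔" => Exp.add
local infixl:65 "∸" => Exp.sub
local infix:50 "≼'" => Test.le
local infix:50 "≺'" => Test.lt
local infix:50 "≐'" => Test.eq
local infixr:35 "⩓" => Test.and
local infix:30 "≔" => Cmd.set

/-- Compute the maximum degree. -/
def maxDegree : Cmd Reg Arr :=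
  block [
    Delta ≔ 0,
    forTo x n [
      k ≔ 0,
      forTo y n [when (cell adj x y ≐' 1) [k ≔ k ∔ 1]],
      when (Delta ≺' k) [Delta ≔ k]]]

/-- Label each vertex with its distance from the root (plus one), by breadth-first search. -/
def labelVertices : Cmd Reg Arr :=
  block [
    forTo x n [putVec label x 0],
    putVec label root 1,
    forTo d n [
      forTo x n [
        when (vec label x ≐' d ∔ 1) [
          forTo y n [
            when (cell adj x y ≐' 1 ⩓ vec label y ≐' 0) [putVec label y (d ∔ 2)]]]]]]

/-- List the children of `v`, where `d` is the label of `v`, and add up their residual numbers. -/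
def listChildren : Cmd Reg Arr :=
  block [
    count ≔ 0,
    total ≔ 0,
    forTo w n [
      when (cell adj v w ≐' 1 ⩓ vec label w ≐' d ∔ 1) [
        putVec child count w,
        total ≔ total ∔ vec res w,
        count ≔ count ∔ 1]]]

/-- Solve the knapsack instance with capacity `c` whose items are the children of `v`, their sizes
(and values) being their residual numbers: `opt[i][w]` is the largest total size, at most `w`, of a
set of items among the first `i` ones. -/
def solveKnapsack : Cmd Reg Arr :=
  block [
    forTo w (c ∔ 1) [put opt 0 w 0],
    forTo i count [
      size ≔ vec res (vec child i),
      forTo w (c ∔ 1) [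
        put opt (i ∔ 1) w (cell opt i w),
        when (size ≼' w ⩓ cell opt i w ≺' cell opt i (w ∸ size) ∔ size) [
          put opt (i ∔ 1) w (cell opt i (w ∸ size) ∔ size)]]]]

/-- Read off an optimal set of children from the table, and mark these children. -/
def markSolution : Cmd Reg Arr :=
  block [
    forTo x n [putVec mark x 0],
    w ≔ c,
    forTo j count [
      i ≔ count ∸ (j ∔ 1),
      when (cell opt i w ≺' cell opt (i ∔ 1) w) [
        putVec mark (vec child i) 1,
        w ≔ w ∸ vec res (vec child i)]]]

/-- Mark all successors of the marked vertices. -/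
def markSuccessors : Cmd Reg Arr :=
  forTo j n [
    forTo x n [
      when (vec label x ≐' j ⩓ vec mark x ≐' 1) [
        forTo y n [
          when (cell adj x y ≐' 1 ⩓ vec label y ≐' j ∔ 1) [putVec mark y 1]]]]]

/-- Color the uncolored edges incident to marked vertices with a new color. -/
def colorMarked : Cmd Reg Arr :=
  block [
    color ≔ color ∔ 1,
    forTo x n [
      when (vec mark x ≐' 1) [
        forTo y n [
          when (cell adj x y ≐' 1 ⩓ cell cur x y ≐' 0) [
            put cur x y color,
            put cur y x color]]]]]

/-- Treat the vertex `v`, whose label is `d`, unless it has no children. -/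
def processVertex : Cmd Reg Arr :=
  block [
    listChildren,
    when (0 ≺' count) [
      solveKnapsack,
      .ite (c ≺' (total ∸ cell opt count c) ∔ vec res v)
        (ok ≔ 0)
        (block [
          markSolution,
          markSuccessors,
          colorMarked,
          putVec res v (vec res v ∔ (total ∸ cell opt count c))])]]

/-- Color the remaining uncolored edges with one new color. -/
def colorRemaining : Cmd Reg Arr :=
  block [
    color ≔ color ∔ 1,
    forTo x n [
      forTo y n [
        when (cell adj x y ≐' 1 ⩓ cell cur x y ≐' 0) [put cur x y color]]]]

/-- Copy the coloring `a` to `b`. -/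
def copyColoring (a b : Arr) : Cmd Reg Arr :=
  forTo x n [forTo y n [put b x y (cell a x y)]]

/-- Test the candidate `c = ⌊(l + u) / 2⌋`, going through the vertices in descending order of
distance from the root, and update the search interval. -/
def testCandidate : Cmd Reg Arr :=
  block [
    forTo x n [putVec res x 1],
    putVec res root 0,
    c ≔ half (l ∔ u),
    forTo x n [forTo y n [put cur x y 0]],
    color ≔ 0,
    ok ≔ 1,
    forTo k n [
      d ≔ n ∸ k,
      forTo v n [
        when (vec label v ≐' d ⩓ ok ≐' 1) [processVertex]]],
    .ite (ok ≐' 1)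
      (block [colorRemaining, copyColoring cur U, u ≔ c, stored ≔ 1])
      (l ≔ c ∔ 1)]

/-- The whole algorithm. A tree with at most one edge is treated separately. -/
def treeColoring : Cmd Reg Arr :=
  block [
    maxDegree,
    .ite (Delta ≼' 1)
      (block [
        m ≔ Delta,
        forTo x n [forTo y n [put M x y 1]]])
      (block [
        m ≔ Delta ∸ 1,
        forTo root n [
          labelVertices,
          l ≔ half (Delta ∔ 1),
          u ≔ Delta ∸ 1,
          stored ≔ 0,
          .loop (.not (l ≐' u ⩓ stored ≐' 1)) testCandidate,
          when (u ≼' m) [m ≔ u, copyColoring U M]]])]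

end Algorithm

/-- The initial memory: the register `n` holds the number of vertices, the array `adj` the
adjacency matrix, and everything else is zero. -/
def input {n : ℕ} (G : SimpleGraph (Fin n)) [DecidableRel G.Adj] : Memory Reg Arr where
  reg := Function.update (fun _ => 0) Reg.n n
  arr := Function.update (fun _ _ _ => 0) Arr.adj fun i j =>
    if h : i < n ∧ j < n then (if G.Adj ⟨i, h.1⟩ ⟨j, h.2⟩ then 1 else 0) else 0

end MinMaxColoring

/-!
Root the tree at `r` and represent every edge by its lower end. In a `2`-coloring, the edges from
`v` to its children have at most one color besides the color of the edge above `v`. When the test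
with candidate `c` leaves a set of children unchosen, their edges continue the color class of the
edge above `v`, and the residual number of `v` counts the edges of this class so far. By induction
from the leaves, every solution whose color groups have size at most `c` has, below each vertex,
at least as many edges of this class as the residual number says: a solution also has to close a
color class at `v`, and the knapsack closes as much as possible. Hence the test fails only if
there is no solution, and if it passes, its coloring is one. Feasibility is monotone in `c`, so
the binary search ends with the optimum; it does so for any root.

The search may start between `⌈Δ / 2⌉` and `Δ - 1`: a vertex of degree `Δ` has two colors, and
giving the edges from each vertex to its children a color of their own, except for one edge at the
root, keeps all color groups at size at most `Δ - 1`. All loops run at most `n` times, hence a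
polynomial in `n`, computed from the nesting of the loops, bounds the number of steps.
-/

namespace MinMaxColoring

/-! ## Total correctness with a time bound -/

section Writes

variable {R A : Type}

/-- The program contains an assignment to the register `x`. -/
def Cmd.writesReg [DecidableEq R] (x : R) : Cmd R A → Bool
  | .skip => false
  | .set y _ => decide (y = x)
  | .put _ _ _ _ => false
  | .seq p q => p.writesReg x || q.writesReg x
  | .ite _ p q => p.writesReg x || q.writesReg x
  | .loop _ p => p.writesReg x

/-- The program contains an assignment to a cell of the array `a`. -/
def Cmd.writesArr [DecidableEq A] (a : A) : Cmd R A → Bool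
  | .skip => false
  | .set _ _ => false
  | .put b _ _ _ => decide (b = a)
  | .seq p q => p.writesArr a || q.writesArr a
  | .ite _ p q => p.writesArr a || q.writesArr a
  | .loop _ p => p.writesArr a

attribute [simp] Exp.eval Exp.vec Test.eval Cmd.writesReg Cmd.writesArr

section SetReg

variable [DecidableEq R]

@[simp] theorem Memory.reg_setReg (σ : Memory R A) (x : R) (k : ℕ) :
    (σ.setReg x k).reg = Function.update σ.reg x k := rfl

@[simp] theorem Memory.arr_setReg (σ : Memory R A) (x : R) (k : ℕ) :
    (σ.setReg x k).arr = σ.arr := rfl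

end SetReg

section SetCell

variable [DecidableEq A]

@[simp] theorem Memory.reg_setCell (σ : Memory R A) (a : A) (i j k : ℕ) :
    (σ.setCell a i j k).reg = σ.reg := rfl

@[simp] theorem Memory.arr_setCell (σ : Memory R A) (a : A) (i j k : ℕ) :
    (σ.setCell a i j k).arr = Function.update σ.arr a
      (Function.update (σ.arr a) i (Function.update (σ.arr a i) j k)) := rfl

end SetCell

variable [DecidableEq R] [DecidableEq A]

/-- The memories `σ` and `σ'` agree on all registers and arrays to which `p` does not write. -/
structure Frame (p : Cmd R A) (σ σ' : Memory R A) : Prop where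
  reg : ∀ x, p.writesReg x = false → σ'.reg x = σ.reg x
  arr : ∀ a, p.writesArr a = false → σ'.arr a = σ.arr a

namespace Frame

variable {p q : Cmd R A} {σ σ' σ'' : Memory R A}

theorem refl (p : Cmd R A) (σ : Memory R A) : Frame p σ σ := ⟨fun _ _ => rfl, fun _ _ => rfl⟩

theorem trans (h : Frame p σ σ') (h' : Frame p σ' σ'') : Frame p σ σ'' :=
  ⟨fun x hx => (h'.reg x hx).trans (h.reg x hx), fun a ha => (h'.arr a ha).trans (h.arr a ha)⟩

theorem weaken (h : Frame p σ σ') (hr : ∀ x, q.writesReg x = false → p.writesReg x = false)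
    (ha : ∀ a, q.writesArr a = false → p.writesArr a = false) : Frame q σ σ' :=
  ⟨fun x hx => h.reg x (hr x hx), fun a h' => h.arr a (ha a h')⟩

theorem seq_left (h : Frame p σ σ') : Frame (.seq p q) σ σ' :=
  h.weaken (by simp +contextual) (by simp +contextual)

theorem seq_right (h : Frame q σ σ') : Frame (.seq p q) σ σ' :=
  h.weaken (by simp +contextual) (by simp +contextual)

theorem ite_left {b : Test R A} (h : Frame p σ σ') : Frame (.ite b p q) σ σ' :=
  h.weaken (by simp +contextual) (by simp +contextual)

theorem ite_right {b : Test R A} (h : Frame q σ σ') : Frame (.ite b p q) σ σ' :=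
  h.weaken (by simp +contextual) (by simp +contextual)

theorem set (x : R) (e : Exp R A) (k : ℕ) : Frame (.set x e) σ (σ.setReg x k) :=
  ⟨fun _ hy => Function.update_of_ne (Ne.symm (by simpa using hy)) _ _, fun _ _ => rfl⟩

theorem put (a : A) (i j e : Exp R A) (i' j' k : ℕ) :
    Frame (.put a i j e) σ (σ.setCell a i' j' k) :=
  ⟨fun _ _ => rfl, fun _ hb => Function.update_of_ne (Ne.symm (by simpa using hb)) _ _⟩

end Frame

end Writes

section TotalCorrectness

variable {R A : Type} [DecidableEq R] [DecidableEq A]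

/-- The command `p` turns the memory `σ` into `τ` in `t` steps, whatever comes after it. -/
def Runs (p : Cmd R A) (σ : Memory R A) (t : ℕ) (τ : Memory R A) : Prop :=
  ∀ s, step^[t] (p :: s, σ) = (s, τ)

/-- A bound for the number of steps of a program all of whose loops are iterated at most `X`
times. -/
noncomputable def timeBound : Cmd R A → Polynomial ℕ
  | .skip => 1
  | .set _ _ => 1
  | .put _ _ _ _ => 1
  | .seq p q => 1 + timeBound p + timeBound q
  | .ite _ p q => 1 + timeBound p + timeBound q
  | .loop _ p => Polynomial.X * (1 + timeBound p) + 1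

/-- Total correctness with a time bound: started in `σ`, the program `p` halts in a memory that
satisfies `Q`, within the time that `timeBound` allows for loops of length at most `N`. -/
def Wp (N : ℕ) (p : Cmd R A) (Q : Memory R A → Prop) (σ : Memory R A) : Prop :=
  ∃ t ≤ (timeBound p).eval N, ∃ σ', Runs p σ t σ' ∧ Frame p σ σ' ∧ Q σ'

variable {N : ℕ} {p q : Cmd R A} {Q Q' : Memory R A → Prop} {σ σ' σ'' : Memory R A}

theorem Wp.haltsIn (h : Wp N p Q σ) :
    ∃ t ≤ (timeBound p).eval N, ∃ σ', HaltsIn p σ t σ' ∧ Q σ' := by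
  obtain ⟨t, ht, σ', hr, -, hq⟩ := h
  exact ⟨t, ht, σ', hr [], hq⟩

theorem Wp.mono (h : Wp N p Q σ) (hQ : ∀ σ', Frame p σ σ' → Q σ' → Q' σ') : Wp N p Q' σ := by
  obtain ⟨t, ht, σ', hr, hf, hq⟩ := h
  exact ⟨t, ht, σ', hr, hf, hQ σ' hf hq⟩

theorem wp_skip (h : Q σ) : Wp N .skip Q σ :=
  ⟨1, by simp [timeBound], σ, fun _ => rfl, .refl _ _, h⟩

theorem wp_set {x : R} {e : Exp R A} (h : Q (σ.setReg x (e.eval σ))) : Wp N (.set x e) Q σ :=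
  ⟨1, by simp [timeBound], _, fun _ => rfl, .set .., h⟩

theorem wp_put {a : A} {i j e : Exp R A}
    (h : Q (σ.setCell a (i.eval σ) (j.eval σ) (e.eval σ))) : Wp N (.put a i j e) Q σ :=
  ⟨1, by simp [timeBound], _, fun _ => rfl, .put .., h⟩

theorem wp_putVec {a : A} {j e : Exp R A} (h : Q (σ.setCell a 0 (j.eval σ) (e.eval σ))) :
    Wp N (.putVec a j e) Q σ := wp_put h

theorem Runs.seq {t t' : ℕ} (h : Runs p σ t σ') (h' : Runs q σ' t' σ'') :
    Runs (.seq p q) σ (t' + t + 1) σ'' := by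
  intro s
  rw [Function.iterate_succ_apply, Function.iterate_add_apply]
  simp only [step]
  rw [h, h']

theorem wp_seq (h : Wp N p (fun σ' => Wp N q Q σ') σ) : Wp N (.seq p q) Q σ := by
  obtain ⟨t, ht, σ', hr, hf, t', ht', σ'', hr', hf', hq⟩ := h
  refine ⟨_, ?_, σ'', hr.seq hr', hf.seq_left.trans hf'.seq_right, hq⟩
  simp only [timeBound, Polynomial.eval_add, Polynomial.eval_one]
  omega

theorem wp_ite {b : Test R A} (h : b.eval σ = true → Wp N p Q σ)
    (h' : b.eval σ = false → Wp N q Q σ) : Wp N (.ite b p q) Q σ := by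
  have hbound : ∀ t, t ≤ (timeBound p).eval N ∨ t ≤ (timeBound q).eval N →
      t + 1 ≤ (timeBound (.ite b p q)).eval N := by
    simp only [timeBound, Polynomial.eval_add, Polynomial.eval_one]
    omega
  rcases hb : b.eval σ with _ | _
  · obtain ⟨t, ht, σ', hr, hf, hq⟩ := h' hb
    refine ⟨t + 1, hbound t (.inr ht), σ', fun s => ?_, hf.ite_right, hq⟩
    simpa [step, hb] using hr s
  · obtain ⟨t, ht, σ', hr, hf, hq⟩ := h hb
    refine ⟨t + 1, hbound t (.inl ht), σ', fun s => ?_, hf.ite_left, hq⟩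
    simpa [step, hb] using hr s

theorem exists_runs_loop {b : Test R A} {I : Memory R A → Prop} {μ : Memory R A → ℕ}
    (hs : ∀ σ, I σ → b.eval σ = true → Wp N p (fun σ' => I σ' ∧ μ σ' < μ σ) σ) (hI : I σ) :
    ∃ t ≤ μ σ * (1 + (timeBound p).eval N) + 1, ∃ σ',
      Runs (.loop b p) σ t σ' ∧ I σ' ∧ b.eval σ' = false := by
  induction hk : μ σ using Nat.strong_induction_on generalizing σ with
  | _ k ih =>
    subst hk
    rcases hb : b.eval σ with _ | _
    · exact ⟨1, by omega, σ, fun s => by simp [step, hb], hI, hb⟩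
    · obtain ⟨t, ht, σ₁, hr, -, hI₁, hμ⟩ := hs σ hI hb
      obtain ⟨t', ht', σ₂, hr', hQ⟩ := ih _ hμ hI₁ rfl
      refine ⟨t' + t + 1, ?_, σ₂, fun s => ?_, hQ⟩
      · have := Nat.mul_le_mul_right (1 + (timeBound p).eval N) hμ
        rw [Nat.succ_mul] at this
        omega
      · rw [Function.iterate_succ_apply, Function.iterate_add_apply]
        simp only [step, hb, if_true]
        rw [hr, hr']

theorem wp_loop {b : Test R A} (I : Memory R A → Prop) (μ : Memory R A → ℕ) (hμ : μ σ ≤ N)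
    (hI : I σ) (hs : ∀ σ', Frame (.loop b p) σ σ' → I σ' → b.eval σ' = true →
      Wp N p (fun σ'' => I σ'' ∧ μ σ'' < μ σ') σ') :
    Wp N (.loop b p) (fun σ' => I σ' ∧ b.eval σ' = false) σ := by
  obtain ⟨t, ht, σ', hr, ⟨hf, hI'⟩, hb⟩ := exists_runs_loop
    (I := fun σ' => Frame (.loop b p) σ σ' ∧ I σ')
    (fun σ' ⟨hf, hI'⟩ hb => (hs σ' hf hI' hb).mono fun σ'' hf' ⟨hI'', hlt⟩ =>
      ⟨⟨hf.trans ⟨hf'.reg, hf'.arr⟩, hI''⟩, hlt⟩) ⟨.refl _ _, hI⟩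
  refine ⟨t, ht.trans ?_, σ', hr, hf, hI', hb⟩
  simp only [timeBound, Polynomial.eval_add, Polynomial.eval_one, Polynomial.eval_mul,
    Polynomial.eval_X]
  gcongr

theorem wp_block_nil (h : Q σ) : Wp N (block []) Q σ := wp_skip h

theorem wp_block_cons {l : List (Cmd R A)} (h : Wp N p (fun σ' => Wp N (block l) Q σ') σ) :
    Wp N (block (p :: l)) Q σ := wp_seq h

theorem wp_block_singleton (h : Wp N p Q σ) : Wp N (block [p]) Q σ :=
  wp_block_cons (h.mono fun _ _ => wp_block_nil)

theorem wp_when {b : Test R A} {l : List (Cmd R A)}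
    (h : b.eval σ = true → Wp N (block l) Q σ) (h' : b.eval σ = false → Q σ) :
    Wp N (when b l) Q σ :=
  wp_ite h fun hb => wp_skip (h' hb)

section ForLoops

variable {x : R} {e : Exp R A} {l : List (Cmd R A)} {E : ℕ}

theorem Frame.forTo (h : Frame (.loop (.lt (.reg x) e)
    (.seq (block l) (.set x (.add (.reg x) (.lit 1))))) (σ.setReg x 0) σ') :
    Frame (forTo x e l) σ σ' :=
  (Frame.set x (.lit 0) 0).seq_left.trans h.seq_right

theorem wp_forTo (I : ℕ → Memory R A → Prop) (hE : E ≤ N) (hx : (block l).writesReg x = false)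
    (he : ∀ σ', Frame (forTo x e l) σ σ' → e.eval σ' = E)
    (hI : ∀ k σ m, I k σ → I k (σ.setReg x m)) (h0 : I 0 σ)
    (hs : ∀ k < E, ∀ σ', Frame (forTo x e l) σ σ' → σ'.reg x = k → I k σ' →
      Wp N (block l) (I (k + 1)) σ')
    (hQ : ∀ σ', Frame (forTo x e l) σ σ' → I E σ' → Q σ') :
    Wp N (forTo x e l) Q σ := by
  suffices Wp N (forTo x e l) (I E) σ from this.mono hQ
  refine wp_seq (wp_set ((wp_loop (fun σ' => σ'.reg x ≤ E ∧ I (σ'.reg x) σ')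
    (fun σ' => E - σ'.reg x) (by simpa using hE) (by simpa using hI 0 σ 0 h0) ?_).mono ?_))
  · rintro σ' hf ⟨-, hI'⟩ hb
    have hlt : σ'.reg x < E := by simpa [he σ' hf.forTo] using hb
    refine wp_seq ((hs _ hlt σ' hf.forTo rfl hI').mono fun σ'' hf' hI'' => wp_set ?_)
    have hreg : σ''.reg x = σ'.reg x := hf'.reg x hx
    simp only [Exp.eval, hreg, Memory.reg_setReg, Function.update_self]
    exact ⟨⟨hlt, hI _ _ _ hI''⟩, by omega⟩
  · rintro σ' hf ⟨⟨hle, hI'⟩, hb⟩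
    have hge : E ≤ σ'.reg x := by
      simpa [he σ' hf.forTo] using hb
    exact hle.antisymm hge ▸ hI'

/-- For loops whose `k`-th iteration only changes the `k`-th component of the sequence `get`. -/
theorem wp_forTo_pointwise {β : Type*} (get : Memory R A → ℕ → β) (F : ℕ → β) (hE : E ≤ N)
    (hx : (block l).writesReg x = false) (he : ∀ σ', Frame (forTo x e l) σ σ' → e.eval σ' = E)
    (hget : ∀ σ m, get (σ.setReg x m) = get σ)
    (hs : ∀ k < E, ∀ σ', Frame (forTo x e l) σ σ' → σ'.reg x = k →
      (∀ j, get σ' j = if j < k then F j else get σ j) →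
      Wp N (block l) (fun σ'' => get σ'' = Function.update (get σ') k (F k)) σ')
    (hQ : ∀ σ', Frame (forTo x e l) σ σ' →
      (∀ k, get σ' k = if k < E then F k else get σ k) → Q σ') :
    Wp N (forTo x e l) Q σ := by
  refine wp_forTo (fun k σ' => ∀ j, get σ' j = if j < k then F j else get σ j) hE hx he
    (fun k σ m h => by rwa [hget]) (by simp) (fun k hk σ' hf hreg hI =>
      (hs k hk σ' hf hreg hI).mono fun σ'' _ h j => ?_) hQ
  rcases lt_trichotomy j k with hj | rfl | hj
  · simp [h, hI, hj.ne, hj, hj.trans (Nat.lt_succ_self k)]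
  · simp [h]
  · simp [h, hI, hj.ne', hj.not_gt, (Nat.succ_le_of_lt hj).not_gt]

end ForLoops

end TotalCorrectness

open Finset

/-! ## Edge colorings of rooted trees -/

/-- A rooted tree on the vertices `0, …, n - 1`, where `depth` is the distance from the root. The
values of `parent` at the root and of `parent` and `depth` outside `0, …, n - 1` are irrelevant. -/
structure RootedTree (n : ℕ) where
  root : ℕ
  parent : ℕ → ℕ
  depth : ℕ → ℕ
  root_lt : root < n
  parent_lt : ∀ x < n, x ≠ root → parent x < n
  depth_root : depth root = 0
  depth_eq : ∀ x < n, x ≠ root → depth x = depth (parent x) + 1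

namespace RootedTree

variable {n : ℕ} (t : RootedTree n)

/-- The children of `v`. -/
def children (v : ℕ) : Finset ℕ :=
  {w ∈ range n | w ≠ t.root ∧ t.parent w = v}

/-- The vertex `x` is in `Z` or is a descendant of a vertex in `Z`. -/
inductive Below (Z : Set ℕ) : ℕ → Prop
  | base {x : ℕ} (hx : x < n) (h : x ∈ Z) : Below Z x
  | step {x : ℕ} (hx : x < n) (hr : x ≠ t.root) (h : Below Z (t.parent x)) : Below Z x

/-- The set `P` contains all children of its elements. -/
def IsDescendantClosed (P : Set ℕ) : Prop :=
  ∀ x < n, x ≠ t.root → t.parent x ∈ P → x ∈ P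

/-- The edges of color `k`. An edge is represented by its lower end, so that the root does not
represent an edge. -/
def colorClass (f : ℕ → ℕ) (k : ℕ) : Finset ℕ :=
  {x ∈ range n | x ≠ t.root ∧ f x = k}

open Classical in
/-- The edges of color `k` whose lower ends are `v` or descendants of `v`. -/
noncomputable def colorClassBelow (f : ℕ → ℕ) (k v : ℕ) : Finset ℕ :=
  {x ∈ t.colorClass f k | t.Below {v} x}

/-- The edge coloring `f` is a `2`-coloring all of whose color groups have size at most `c`. In
`exists_color`, the color of the edge above `v` is `f v`, so that `K` is the second color at `v`;
at the root, `f v` stands for one of the two colors. -/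
structure IsSolution (c : ℕ) (f : ℕ → ℕ) : Prop where
  exists_color : ∀ v < n, ∃ K, ∀ w ∈ t.children v, f w = K ∨ f w = f v
  card_colorClass_le : ∀ k, #(t.colorClass f k) ≤ c

variable {t} {c x v w k : ℕ} {Z : Set ℕ} {f : ℕ → ℕ}

theorem mem_children : w ∈ t.children v ↔ w < n ∧ w ≠ t.root ∧ t.parent w = v := by
  simp [children]

theorem mem_colorClass : x ∈ t.colorClass f k ↔ x < n ∧ x ≠ t.root ∧ f x = k := by
  simp [colorClass]

theorem mem_colorClassBelow :
    x ∈ t.colorClassBelow f k v ↔ x ∈ t.colorClass f k ∧ t.Below {v} x := by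
  simp [colorClassBelow]

theorem lt_of_mem_children (hw : w ∈ t.children v) : w < n := (mem_children.1 hw).1

theorem parent_eq_of_mem_children (hw : w ∈ t.children v) : t.parent w = v :=
  (mem_children.1 hw).2.2

theorem depth_of_mem_children (hw : w ∈ t.children v) : t.depth w = t.depth v + 1 := by
  obtain ⟨hwn, hwr, rfl⟩ := mem_children.1 hw
  exact t.depth_eq w hwn hwr

theorem ne_root_of_depth_ne_zero (h : t.depth x ≠ 0) : x ≠ t.root := by
  rintro rfl
  exact h t.depth_root

theorem depth_eq_zero_iff (hx : x < n) : t.depth x = 0 ↔ x = t.root := by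
  refine ⟨fun h => ?_, fun h => h ▸ t.depth_root⟩
  by_contra hr
  have := t.depth_eq x hx hr
  omega

theorem exists_depth_eq (hx : x < n) {d : ℕ} (hd : d ≤ t.depth x) : ∃ y < n, t.depth y = d := by
  induction hD : t.depth x generalizing x with
  | zero => exact ⟨x, hx, by omega⟩
  | succ D ih =>
    by_cases hdx : d = t.depth x
    · exact ⟨x, hx, hdx.symm⟩
    · have hr : x ≠ t.root := ne_root_of_depth_ne_zero (by omega)
      have := t.depth_eq x hx hr
      exact ih (t.parent_lt x hx hr) (by omega) (by omega)

theorem depth_lt (hx : x < n) : t.depth x < n := by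
  have hsub : range (t.depth x + 1) ⊆ (range n).image t.depth := fun d hd => by
    obtain ⟨y, hy, h⟩ := exists_depth_eq hx (Nat.lt_succ_iff.1 (mem_range.1 hd))
    exact mem_image.2 ⟨y, mem_range.2 hy, h⟩
  simpa using (card_le_card hsub).trans card_image_le

/-! ### Descendants -/

theorem below_iff (hx : x < n) :
    t.Below Z x ↔ x ∈ Z ∨ (x ≠ t.root ∧ t.Below Z (t.parent x)) := by
  constructor
  · rintro (⟨_, h⟩ | ⟨_, h, h'⟩)
    · exact .inl h
    · exact .inr ⟨h, h'⟩
  · rintro (h | ⟨h, h'⟩)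
    · exact .base hx h
    · exact .step hx h h'

theorem Below.exists_mem (h : t.Below Z x) : ∃ z ∈ Z, t.Below {z} x := by
  induction h with
  | base hx h => exact ⟨_, h, .base hx rfl⟩
  | step hx hr _ ih => exact ih.imp fun z ⟨hz, h⟩ => ⟨hz, .step hx hr h⟩

theorem Below.mono {Z' : Set ℕ} (hZ : Z ⊆ Z') (h : t.Below Z x) : t.Below Z' x := by
  induction h with
  | base hx h => exact .base hx (hZ h)
  | step hx hr _ ih => exact .step hx hr ih

theorem Below.trans {y : ℕ} (h : t.Below Z x) (h' : t.Below {x} y) : t.Below Z y := by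
  induction h' with
  | base _ hy => exact Set.mem_singleton_iff.1 hy ▸ h
  | step hx hr _ ih => exact .step hx hr ih

theorem Below.mem_of_isDescendantClosed {P : Set ℕ} (hP : t.IsDescendantClosed P) (hZ : Z ⊆ P)
    (h : t.Below Z x) : x ∈ P := by
  induction h with
  | base _ h => exact hZ h
  | step hx hr _ ih => exact hP _ hx hr ih

theorem Below.depth_le (h : t.Below {v} x) : t.depth v ≤ t.depth x := by
  induction h with
  | base _ h => rw [Set.mem_singleton_iff.1 h]
  | step hx hr _ ih => exact ih.trans ((t.depth_eq _ hx hr).ge.trans' (Nat.le_succ _))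

theorem Below.depth_lt_of_subset_children (h : t.Below Z x) (hZ : Z ⊆ t.children v) :
    t.depth v < t.depth x := by
  obtain ⟨z, hz, hb⟩ := h.exists_mem
  exact (Nat.lt_of_succ_le (depth_of_mem_children (hZ hz)).ge).trans_le hb.depth_le

theorem Below.eq_of_depth_eq {u : ℕ} (h : t.Below {u} x) (h' : t.Below {v} x)
    (hd : t.depth u = t.depth v) : u = v := by
  induction h with
  | @base x hx h =>
    obtain rfl : x = u := h
    rcases (below_iff hx).1 h' with h | ⟨hr, h⟩
    · exact h
    · have := h.depth_le
      have := t.depth_eq _ hx hr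
      omega
  | @step x hx hr hb ih =>
    rcases (below_iff hx).1 h' with h | ⟨_, h⟩
    · obtain rfl : x = v := h
      have := hb.depth_le
      have := t.depth_eq _ hx hr
      omega
    · exact ih h

theorem below_root (hx : x < n) : t.Below {t.root} x := by
  induction hd : t.depth x generalizing x with
  | zero => exact .base hx ((depth_eq_zero_iff hx).1 hd)
  | succ d ih =>
    have hr : x ≠ t.root := ne_root_of_depth_ne_zero (by omega)
    have := t.depth_eq x hx hr
    exact .step hx hr (ih (t.parent_lt x hx hr) (by omega))

theorem below_singleton_iff (hv : v < n) :
    t.Below {v} x ↔ x = v ∨ ∃ w ∈ t.children v, t.Below {w} x := by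
  constructor
  · intro h
    induction h with
    | base _ h => exact .inl h
    | @step x hx hr _ ih =>
      rcases ih with h | ⟨w, hw, h⟩
      · exact .inr ⟨x, mem_children.2 ⟨hx, hr, h⟩, .base hx rfl⟩
      · exact .inr ⟨w, hw, .step hx hr h⟩
  · rintro (rfl | ⟨w, hw, h⟩)
    · exact .base hv rfl
    · obtain ⟨hwn, hwr, rfl⟩ := mem_children.1 hw
      exact (Below.step hwn hwr (.base hv (Set.mem_singleton _))).trans h

/-! ### Sizes of color classes -/

theorem colorClassBelow_subset : t.colorClassBelow f k v ⊆ t.colorClass f k :=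
  fun _ hx => (mem_colorClassBelow.1 hx).1

theorem sum_card_colorClassBelow {S : Finset ℕ} (hS : S ⊆ t.children v) (f : ℕ → ℕ) (k : ℕ) :
    ∑ w ∈ S, #(t.colorClassBelow f k w) = #(S.biUnion (t.colorClassBelow f k)) := by
  refine (card_biUnion fun w hw w' hw' hne => disjoint_left.2 fun x hx hx' => hne ?_).symm
  exact (mem_colorClassBelow.1 hx).2.eq_of_depth_eq (mem_colorClassBelow.1 hx').2
    ((depth_of_mem_children (hS hw)).trans (depth_of_mem_children (hS hw')).symm)

theorem notMem_biUnion_colorClassBelow :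
    v ∉ (t.children v).biUnion (t.colorClassBelow f k) := by
  rw [mem_biUnion]
  rintro ⟨w, hw, h⟩
  have := depth_of_mem_children hw
  have := (mem_colorClassBelow.1 h).2.depth_le
  omega

theorem colorClassBelow_eq_union (hv : v < n) :
    t.colorClassBelow f k v = (if v ≠ t.root ∧ f v = k then {v} else ∅) ∪
      (t.children v).biUnion (t.colorClassBelow f k) := by
  ext x
  simp only [mem_union, mem_biUnion, mem_colorClassBelow, below_singleton_iff hv]
  split_ifs with h
  · rw [mem_singleton]
    constructor
    · rintro ⟨hx, hxv | ⟨w, hw, hb⟩⟩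
      · exact .inl hxv
      · exact .inr ⟨w, hw, hx, hb⟩
    · rintro (rfl | ⟨w, hw, hx, hb⟩)
      · exact ⟨mem_colorClass.2 ⟨hv, h⟩, .inl rfl⟩
      · exact ⟨hx, .inr ⟨w, hw, hb⟩⟩
  · simp only [notMem_empty, false_or]
    constructor
    · rintro ⟨hx, rfl | ⟨w, hw, hb⟩⟩
      · exact absurd (mem_colorClass.1 hx).2 h
      · exact ⟨w, hw, hx, hb⟩
    · rintro ⟨w, hw, hx, hb⟩
      exact ⟨hx, .inr ⟨w, hw, hb⟩⟩

theorem card_colorClassBelow (hv : v < n) :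
    #(t.colorClassBelow f k v) = (if v ≠ t.root ∧ f v = k then 1 else 0) +
      ∑ w ∈ t.children v, #(t.colorClassBelow f k w) := by
  rw [sum_card_colorClassBelow subset_rfl, colorClassBelow_eq_union hv]
  split_ifs
  · rw [card_union_of_disjoint (disjoint_singleton_left.2 notMem_biUnion_colorClassBelow),
      card_singleton]
  · simp

theorem IsSolution.mono {c' : ℕ} (h : t.IsSolution c f) (hc : c ≤ c') : t.IsSolution c' f :=
  ⟨h.exists_color, fun k => (h.card_colorClass_le k).trans hc⟩

theorem IsSolution.card_colorClassBelow_le (hf : t.IsSolution c f) (k v : ℕ) :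
    #(t.colorClassBelow f k v) ≤ c :=
  (card_le_card colorClassBelow_subset).trans (hf.card_colorClass_le k)

/-- The children of `v` whose color is not that of `v` share a single color, so the algorithm
could have chosen them: the residual numbers never exceed those that any solution needs. -/
theorem IsSolution.residual_le (hf : t.IsSolution c f) {res : ℕ → ℕ}
    (hres : ∀ w ∈ t.children v, res w ≤ #(t.colorClassBelow f (f w) w)) {B : ℕ} (hv : v < n)
    (hresv : res v = if v = t.root then 0 else 1)
    (hB : ∀ S ⊆ t.children v, ∑ w ∈ S, res w ≤ c → ∑ w ∈ S, res w ≤ B) :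
    (∑ w ∈ t.children v, res w - B) + res v ≤ #(t.colorClassBelow f (f v) v) := by
  obtain ⟨K, hK⟩ := hf.exists_color v hv
  have hother : ∑ w ∈ t.children v with f w ≠ f v, res w ≤ c := by
    calc ∑ w ∈ t.children v with f w ≠ f v, res w
        ≤ ∑ w ∈ t.children v with f w ≠ f v, #(t.colorClassBelow f K w) := by
          refine sum_le_sum fun w hw => ?_
          obtain ⟨hw, hne⟩ := mem_filter.1 hw
          exact (hK w hw).resolve_right hne ▸ hres w hw
      _ = #(({w ∈ t.children v | f w ≠ f v}).biUnion (t.colorClassBelow f K)) :=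
          sum_card_colorClassBelow (filter_subset _ _) f K
      _ ≤ c := (card_le_card (biUnion_subset.2 fun w _ => colorClassBelow_subset)).trans
          (hf.card_colorClass_le K)
  have hsame : ∑ w ∈ t.children v with ¬ f w ≠ f v, res w ≤
      ∑ w ∈ t.children v, #(t.colorClassBelow f (f v) w) := by
    refine (sum_le_sum fun w hw => ?_).trans (sum_le_sum_of_subset (filter_subset _ _))
    rw [mem_filter, not_not] at hw
    exact hw.2 ▸ hres w hw.1
  have hotherB := hB _ (filter_subset _ _) hother
  have hsplit := sum_filter_add_sum_filter_not (t.children v) (fun w => f w ≠ f v) res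
  have hcard := t.card_colorClassBelow (f := f) (k := f v) hv
  have hself : res v = if v ≠ t.root ∧ f v = f v then 1 else 0 := by
    rw [hresv]
    split_ifs <;> simp_all
  omega

end RootedTree

/-! ### Growing a solution from the leaves -/

namespace RootedTree

variable {n : ℕ} {t : RootedTree n} {c v K x : ℕ} {P S : Set ℕ} {res col : ℕ → ℕ}

/-- The state of a test for the candidate `c` after the vertices in `P` have been treated: the
residual numbers are `res`, the colors are `col`, and `0` stands for uncolored. In `exists_color`,
the edges of color `col v` are uncolored if the edge above `v` is. -/
structure PartialSolution (t : RootedTree n) (c : ℕ) (P : Set ℕ) (res col : ℕ → ℕ) : Prop where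
  closed : t.IsDescendantClosed P
  res_of_notMem : ∀ x < n, x ∉ P → res x = if x = t.root then 0 else 1
  res_le : ∀ x < n, res x ≤ c
  col_root : col t.root = 0
  col_of_parent_notMem : ∀ x < n, x ≠ t.root → t.parent x ∉ P → col x = 0
  card_colorClass_le : ∀ k ≠ 0, #(t.colorClass col k) ≤ c
  exists_color : ∀ v < n, v ∈ P → ∃ K ≠ 0, ∀ w ∈ t.children v, col w = K ∨ col w = col v
  card_uncolored : ∀ v < n, v ∈ P → col v = 0 → #(t.colorClassBelow col 0 v) = res v

open Classical in
/-- The coloring obtained from `f` by giving color `K` to the uncolored edges whose lower ends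
satisfy `p`. -/
noncomputable def paint (f : ℕ → ℕ) (p : ℕ → Prop) (K : ℕ) : ℕ → ℕ :=
  fun x => if f x = 0 ∧ p x then K else f x

/-- The coloring obtained from `col` by giving color `K` to the uncolored edges whose lower ends are
in `S` or descendants of `S`. -/
noncomputable def recolor (t : RootedTree n) (col : ℕ → ℕ) (S : Set ℕ) (K : ℕ) : ℕ → ℕ :=
  paint col (t.Below S) K

theorem recolor_of_below (hx : col x = 0) (hb : t.Below S x) : t.recolor col S K x = K :=
  if_pos ⟨hx, hb⟩

theorem recolor_of_not_below (hb : ¬ t.Below S x) : t.recolor col S K x = col x :=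
  if_neg fun h => hb h.2

theorem recolor_of_ne_zero (hx : col x ≠ 0) : t.recolor col S K x = col x :=
  if_neg fun h => hx h.1

theorem recolor_eq_zero_iff (hK : K ≠ 0) :
    t.recolor col S K x = 0 ↔ col x = 0 ∧ ¬ t.Below S x := by
  unfold recolor paint
  split_ifs with h <;> tauto

theorem colorClass_recolor_subset {k : ℕ} (hk : k ≠ K) :
    t.colorClass (t.recolor col S K) k ⊆ t.colorClass col k := by
  intro x hx
  obtain ⟨hxn, hxr, hx⟩ := mem_colorClass.1 hx
  refine mem_colorClass.2 ⟨hxn, hxr, ?_⟩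
  unfold recolor paint at hx
  split_ifs at hx
  · exact absurd hx.symm hk
  · exact hx

theorem colorClass_recolor_self_subset {S : Finset ℕ} (hcol : ∀ x < n, col x ≠ K) :
    t.colorClass (t.recolor col S K) K ⊆ S.biUnion (t.colorClassBelow col 0) := by
  intro x hx
  obtain ⟨hxn, hxr, hx⟩ := mem_colorClass.1 hx
  have hb : t.Below S x := by
    by_contra hb
    exact hcol x hxn ((recolor_of_not_below hb).symm.trans hx)
  have h0 : col x = 0 := by
    by_contra h0
    exact hcol x hxn ((recolor_of_ne_zero h0).symm.trans hx)
  obtain ⟨z, hz, hzx⟩ := hb.exists_mem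
  exact mem_biUnion.2 ⟨z, hz, mem_colorClassBelow.2 ⟨mem_colorClass.2 ⟨hxn, hxr, h0⟩, hzx⟩⟩

theorem colorClassBelow_recolor_of_disjoint (hK : K ≠ 0)
    (hv : ∀ x, t.Below {v} x → ¬ t.Below S x) :
    t.colorClassBelow (t.recolor col S K) 0 v = t.colorClassBelow col 0 v := by
  ext x
  simp only [mem_colorClassBelow, mem_colorClass, recolor_eq_zero_iff hK]
  have := hv x
  tauto

theorem colorClassBelow_recolor_of_mem (hK : K ≠ 0) (hv : v ∈ S) :
    t.colorClassBelow (t.recolor col S K) 0 v = ∅ := by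
  refine eq_empty_of_forall_notMem fun x hx => ?_
  rw [mem_colorClassBelow, mem_colorClass, recolor_eq_zero_iff hK] at hx
  exact hx.1.2.2.2 (hx.2.mono (Set.singleton_subset_iff.2 hv))

theorem not_below_of_mem_children (hS : S ⊆ t.children v) {w : ℕ} (hw : w ∈ t.children v)
    (hwS : w ∉ S) (h : t.Below {w} x) : ¬ t.Below S x := by
  intro hx
  obtain ⟨z, hz, hzx⟩ := hx.exists_mem
  refine hwS (h.eq_of_depth_eq hzx ?_ ▸ hz)
  rw [depth_of_mem_children hw, depth_of_mem_children (hS hz)]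

theorem not_below_of_subset_children (hS : S ⊆ t.children v) : ¬ t.Below S v :=
  fun h => (h.depth_lt_of_subset_children hS).false

theorem root_not_below_of_subset_children (hS : S ⊆ t.children v) : ¬ t.Below S t.root :=
  fun h => (t.depth_root ▸ h.depth_lt_of_subset_children hS).not_ge (Nat.zero_le _)

theorem below_iff_below_parent (hS : S ⊆ t.children v) (hx : x < n) (hr : x ≠ t.root)
    (hxv : t.parent x ≠ v) : t.Below S x ↔ t.Below S (t.parent x) := by
  rw [below_iff hx, or_iff_right fun h => hxv (parent_eq_of_mem_children (hS h)),
    and_iff_right hr]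

theorem not_below_of_isDescendantClosed (hP : t.IsDescendantClosed P) (hv : v ∉ P)
    (hS : S ⊆ t.children v) {u : ℕ} (hu : u ∈ P) (huS : ¬ t.Below S u) (h : t.Below {u} x) :
    ¬ t.Below S x := by
  induction h with
  | base _ h => rwa [Set.mem_singleton_iff.1 h]
  | @step x hx hr hb ih =>
    have hpar : t.parent x ∈ P :=
      hb.mem_of_isDescendantClosed hP (Set.singleton_subset_iff.2 hu)
    rwa [below_iff_below_parent hS hx hr fun h => hv (h ▸ hpar)]

namespace PartialSolution

theorem start (hc : 1 ≤ c) (hP : ∀ x < n, x ∉ P)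
    (hres : ∀ x < n, res x = if x = t.root then 0 else 1) :
    t.PartialSolution c P res (fun _ => 0) where
  closed x hx hr h := absurd h (hP _ (t.parent_lt x hx hr))
  res_of_notMem x hx _ := hres x hx
  res_le x hx := by rw [hres x hx]; split_ifs <;> omega
  col_root := rfl
  col_of_parent_notMem _ _ _ _ := rfl
  card_colorClass_le k hk := by simp [colorClass, hk.symm]
  exists_color v hv h := absurd h (hP v hv)
  card_uncolored v hv h := absurd h (hP v hv)

variable (h : t.PartialSolution c P res col)
include h

theorem col_of_mem_children (hv : v ∉ P) {w : ℕ} (hw : w ∈ t.children v) : col w = 0 := by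
  obtain ⟨hwn, hwr, rfl⟩ := mem_children.1 hw
  exact h.col_of_parent_notMem w hwn hwr hv

theorem col_of_notMem (hv : v < n) (hvP : v ∉ P) : col v = 0 := by
  by_cases hr : v = t.root
  · rw [hr, h.col_root]
  · exact h.col_of_parent_notMem v hv hr fun hp => hvP (h.closed v hv hr hp)

theorem card_uncolored_of_mem_children (hv : v ∉ P) (hch : ∀ w ∈ t.children v, w ∈ P) {w : ℕ}
    (hw : w ∈ t.children v) : #(t.colorClassBelow col 0 w) = res w :=
  h.card_uncolored w (lt_of_mem_children hw) (hch w hw) (h.col_of_mem_children hv hw)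

theorem card_colorClass_recolor_le (hv : v ∉ P) (hch : ∀ w ∈ t.children v, w ∈ P) {S : Finset ℕ}
    (hS : S ⊆ t.children v) (hSc : ∑ w ∈ S, res w ≤ c) (hcol : ∀ x < n, col x ≠ K) {k : ℕ}
    (hk : k ≠ 0) : #(t.colorClass (t.recolor col S K) k) ≤ c := by
  rcases eq_or_ne k K with rfl | hkK
  · calc #(t.colorClass (t.recolor col S k) k)
        ≤ #(S.biUnion (t.colorClassBelow col 0)) :=
          card_le_card (colorClass_recolor_self_subset hcol)
      _ = ∑ w ∈ S, #(t.colorClassBelow col 0 w) := (sum_card_colorClassBelow hS col 0).symm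
      _ = ∑ w ∈ S, res w :=
          sum_congr rfl fun w hw => h.card_uncolored_of_mem_children hv hch (hS hw)
      _ ≤ c := hSc
  · exact (card_le_card (colorClass_recolor_subset hkK)).trans (h.card_colorClass_le k hk)

theorem recolor_mem_children (hv : v < n) (hvP : v ∉ P) (hS : S ⊆ t.children v) {w : ℕ}
    (hw : w ∈ t.children v) :
    t.recolor col S K w = K ∨ t.recolor col S K w = t.recolor col S K v := by
  have hw0 := h.col_of_mem_children hvP hw
  by_cases hb : t.Below S w
  · exact .inl (recolor_of_below hw0 hb)
  · rw [recolor_of_not_below hb, hw0, recolor_of_not_below (not_below_of_subset_children hS),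
      h.col_of_notMem hv hvP]
    exact .inr rfl

theorem exists_color_recolor (hvP : v ∉ P) (hS : S ⊆ t.children v) {u : ℕ} (hu : u < n)
    (huP : u ∈ P) : ∃ L ≠ 0, ∀ w ∈ t.children u,
      t.recolor col S K w = L ∨ t.recolor col S K w = t.recolor col S K u := by
  obtain ⟨L, hL, hcol⟩ := h.exists_color u hu huP
  refine ⟨L, hL, fun w hw => ?_⟩
  rcases hcol w hw with hwL | hwu
  · exact .inl ((recolor_of_ne_zero (hwL ▸ hL)).trans hwL)
  · obtain ⟨hwn, hwr, rfl⟩ := mem_children.1 hw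
    have hiff := below_iff_below_parent hS hwn hwr fun hp => hvP (hp ▸ huP)
    right
    unfold recolor paint
    rw [hiff, hwu]

theorem card_uncolored_recolor_self (hv : v < n) (hvP : v ∉ P)
    (hch : ∀ w ∈ t.children v, w ∈ P) {S : Finset ℕ} (hS : S ⊆ t.children v) (hK : K ≠ 0) :
    #(t.colorClassBelow (t.recolor col S K) 0 v) = res v + ∑ w ∈ t.children v \ S, res w := by
  have houtside : ∀ w ∈ t.children v \ S, #(t.colorClassBelow (t.recolor col S K) 0 w) = res w := by
    intro w hw
    obtain ⟨hw, hwS⟩ := mem_sdiff.1 hw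
    rw [colorClassBelow_recolor_of_disjoint hK fun x => not_below_of_mem_children hS hw hwS,
      h.card_uncolored_of_mem_children hvP hch hw]
  have hinside : ∀ w ∈ S, #(t.colorClassBelow (t.recolor col S K) 0 w) = 0 := fun w hw => by
    rw [colorClassBelow_recolor_of_mem hK (mem_coe.2 hw), card_empty]
  have hv0 : t.recolor col S K v = 0 := by
    rw [recolor_of_not_below (not_below_of_subset_children hS), h.col_of_notMem hv hvP]
  rw [card_colorClassBelow hv, h.res_of_notMem v hv hvP, ← sum_sdiff hS, sum_congr rfl houtside,
    sum_eq_zero hinside, add_zero]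
  simp only [hv0, and_true, ne_eq, ite_not]

theorem card_uncolored_recolor (hvP : v ∉ P) (hS : S ⊆ t.children v) (hK : K ≠ 0) {u : ℕ}
    (hu : u < n) (huP : u ∈ P) (hu0 : t.recolor col S K u = 0) :
    #(t.colorClassBelow (t.recolor col S K) 0 u) = res u := by
  obtain ⟨hu0, hub⟩ := (recolor_eq_zero_iff hK).1 hu0
  rw [colorClassBelow_recolor_of_disjoint hK fun x =>
    not_below_of_isDescendantClosed h.closed hvP hS huP hub, h.card_uncolored u hu huP hu0]

theorem treat (hv : v < n) (hvP : v ∉ P) (hch : ∀ w ∈ t.children v, w ∈ P) {S : Finset ℕ}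
    (hS : S ⊆ t.children v) (hSc : ∑ w ∈ S, res w ≤ c) (hK : K ≠ 0)
    (hcol : ∀ x < n, col x ≠ K) (hR : res v + ∑ w ∈ t.children v \ S, res w ≤ c) :
    t.PartialSolution c (insert v P)
      (Function.update res v (res v + ∑ w ∈ t.children v \ S, res w)) (t.recolor col S K) where
  closed x hx hr hxP := by
    rcases hxP with rfl | hxP
    · exact .inr (hch x (mem_children.2 ⟨hx, hr, rfl⟩))
    · exact .inr (h.closed x hx hr hxP)
  res_of_notMem x hx hxP := by
    rw [Set.mem_insert_iff, not_or] at hxP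
    rw [Function.update_of_ne hxP.1, h.res_of_notMem x hx hxP.2]
  res_le x hx := by
    rw [Function.update_apply]
    split_ifs
    · exact hR
    · exact h.res_le x hx
  col_root := by
    rw [recolor_of_not_below (root_not_below_of_subset_children hS), h.col_root]
  col_of_parent_notMem x hx hr hxP := by
    rw [Set.mem_insert_iff, not_or] at hxP
    refine (recolor_eq_zero_iff hK).2 ⟨h.col_of_parent_notMem x hx hr hxP.2, fun hb => hxP.2 ?_⟩
    exact ((below_iff_below_parent hS hx hr hxP.1).1 hb).mem_of_isDescendantClosed h.closed
      fun w hw => hch w (hS hw)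
  card_colorClass_le _ := h.card_colorClass_recolor_le hvP hch hS hSc hcol
  exists_color u hu huP := by
    rcases huP with rfl | huP
    · exact ⟨K, hK, fun w => h.recolor_mem_children hu hvP hS⟩
    · exact h.exists_color_recolor hvP hS hu huP
  card_uncolored u hu huP hu0 := by
    rcases huP with rfl | huP
    · rw [Function.update_self, h.card_uncolored_recolor_self hu hvP hch hS hK]
    · rw [Function.update_of_ne (ne_of_mem_of_not_mem huP hvP),
        h.card_uncolored_recolor hvP hS hK hu huP hu0]

theorem isSolution (hP : ∀ x < n, x ∈ P) (hcol : ∀ x < n, col x ≠ K) :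
    t.IsSolution c fun x => if col x = 0 then K else col x where
  exists_color v hv := by
    obtain ⟨L, hL, hw⟩ := h.exists_color v hv (hP v hv)
    refine ⟨L, fun w hwv => (hw w hwv).imp (fun hwL => ?_) fun hwv => ?_⟩
    · rw [hwL, if_neg hL]
    · rw [hwv]
  card_colorClass_le k := by
    have hr := t.root_lt
    rcases eq_or_ne k K with rfl | hkK
    · refine (card_le_card fun x hx => ?_).trans
        ((h.card_uncolored _ hr (hP _ hr) h.col_root).trans_le (h.res_le _ hr))
      obtain ⟨hxn, hxr, hx⟩ := mem_colorClass.1 hx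
      refine mem_colorClassBelow.2 ⟨mem_colorClass.2 ⟨hxn, hxr, ?_⟩, below_root hxn⟩
      by_contra h0
      exact hcol x hxn ((if_neg h0).symm.trans hx)
    · rcases Nat.eq_zero_or_pos #(t.colorClass (fun x => if col x = 0 then K else col x) k)
        with h0 | hpos
      · omega
      have hk0 : k ≠ 0 := by
        rintro rfl
        obtain ⟨x, hx⟩ := card_pos.1 hpos
        have := (mem_colorClass.1 hx).2.2
        split_ifs at this with hx0
        exacts [hkK this.symm, hx0 this]
      refine (card_le_card fun x hx => ?_).trans (h.card_colorClass_le k hk0)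
      obtain ⟨hxn, hxr, hx⟩ := mem_colorClass.1 hx
      split_ifs at hx
      exacts [absurd hx.symm hkK, mem_colorClass.2 ⟨hxn, hxr, hx⟩]

end PartialSolution

end RootedTree

/-! ## The subroutines of the algorithm -/

section MatrixLoops

variable {R A : Type} [DecidableEq R] [DecidableEq A] {N E : ℕ} {σ : Memory R A}

theorem wp_forTo_row {y : R} {e : Exp R A} {l : List (Cmd R A)} (a : A) (i : ℕ) (F : ℕ → ℕ)
    (hE : E ≤ N) (hy : (block l).writesReg y = false)
    (he : ∀ σ', Frame (forTo y e l) σ σ' → e.eval σ' = E)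
    (hs : ∀ j < E, ∀ σ', Frame (forTo y e l) σ σ' → σ'.reg y = j →
      σ'.arr a = Function.update (σ.arr a) i (fun j' => if j' < j then F j' else σ.arr a i j') →
      Wp N (block l) (fun σ'' => σ''.arr a =
        Function.update (σ'.arr a) i (Function.update (σ'.arr a i) j (F j))) σ') :
    Wp N (forTo y e l) (fun σ' => σ'.arr a = Function.update (σ.arr a) i
      fun j => if j < E then F j else σ.arr a i j) σ := by
  refine wp_forTo (fun k σ' => σ'.arr a = Function.update (σ.arr a) i
    fun j => if j < k then F j else σ.arr a i j) hE hy he (fun _ _ _ h => h) (by simp) ?_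
    fun _ _ h => h
  intro j hj σ₁ hf₁ hy₁ h₁
  refine (hs j hj σ₁ hf₁ hy₁ h₁).mono fun σ₂ _ h₂ => ?_
  rw [h₂, h₁, Function.update_self, Function.update_idem]
  congr 1
  ext j'
  rcases lt_trichotomy j' j with h | rfl | h
  · simp [h.ne, h, h.trans (Nat.lt_succ_self j)]
  · simp
  · simp [h.ne', h.not_gt, (Nat.succ_le_of_lt h).not_gt]

theorem wp_forTo_forTo {x y : R} {e : Exp R A} {l : List (Cmd R A)} (a : A) (F : ℕ → ℕ → ℕ)
    (hxy : x ≠ y) (hE : E ≤ N) (hx : (block l).writesReg x = false)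
    (hy : (block l).writesReg y = false)
    (he : ∀ σ', Frame (forTo x e [forTo y e l]) σ σ' → e.eval σ' = E)
    (hs : ∀ i < E, ∀ j < E, ∀ σ', Frame (forTo x e [forTo y e l]) σ σ' → σ'.reg x = i →
      σ'.reg y = j → σ'.arr a i j = σ.arr a i j → Wp N (block l) (fun σ'' => σ''.arr a =
        Function.update (σ'.arr a) i (Function.update (σ'.arr a i) j (F i j))) σ') :
    Wp N (forTo x e [forTo y e l]) (fun σ' => ∀ i < E, ∀ j < E, σ'.arr a i j = F i j) σ := by
  have hinner : ∀ {i σ₁ σ₂}, Frame (forTo x e [forTo y e l]) σ σ₁ → σ₁.reg x = i →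
      Frame (forTo y e l) σ₁ σ₂ → Frame (forTo x e [forTo y e l]) σ σ₂ ∧ σ₂.reg x = i := by
    refine fun hf hi hf' => ⟨hf.trans (hf'.weaken ?_ ?_), (hf'.reg x ?_).trans hi⟩ <;>
      simp_all [forTo, block, Ne.symm hxy]
  refine wp_forTo_pointwise (fun σ' => σ'.arr a) (fun i j => if j < E then F i j else σ.arr a i j)
    hE (by simp_all [forTo, block, Ne.symm hxy]) he (fun _ _ => rfl) (fun i hi σ₁ hf₁ hx₁ h₁ =>
      wp_block_singleton ?_) fun σ' _ h i hi j hj => by rw [h, if_pos hi, if_pos hj]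
  refine (wp_forTo_row a i (F i) hE hy (fun σ₂ hf₂ => he σ₂ (hinner hf₁ hx₁ hf₂).1) ?_).mono
    fun σ₂ _ h₂ => by simpa [h₁] using h₂
  intro j hj σ₂ hf₂ hy₂ h₂
  obtain ⟨hf, hx₂⟩ := hinner hf₁ hx₁ hf₂
  exact hs i hi j hj σ₂ hf hx₂ hy₂ (by simp [h₂, h₁])

end MatrixLoops

section SimpleLoops

variable {n N : ℕ} {σ : Memory Reg Arr}

theorem wp_fill (b : Arr) (m : ℕ) (hN : n ≤ N) (hn : σ.reg .n = n) :
    Wp N (forTo .x (.reg .n) [.putVec b (.reg .x) (.lit m)])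
      (fun σ' => ∀ x < n, σ'.arr b 0 x = m) σ := by
  refine wp_forTo_pointwise (fun σ' => σ'.arr b 0) (fun _ => m) hN rfl
    (fun σ' hf => (hf.reg .n rfl).trans hn) (fun _ _ => rfl) (fun x _ σ' _ hx _ =>
      wp_block_singleton (wp_putVec ?_)) fun σ' _ h x hx => by rw [h, if_pos hx]
  simp [hx]

theorem wp_fillMatrix (b : Arr) (m : ℕ) (hN : n ≤ N) (hn : σ.reg .n = n) :
    Wp N (forTo .x (.reg .n) [forTo .y (.reg .n) [.put b (.reg .x) (.reg .y) (.lit m)]])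
      (fun σ' => ∀ x < n, ∀ y < n, σ'.arr b x y = m) σ := by
  refine wp_forTo_forTo b (fun _ _ => m) (by decide) hN rfl rfl
    (fun σ' hf => (hf.reg .n rfl).trans hn) fun x _ y _ σ' _ hx hy _ =>
      wp_block_singleton (wp_put ?_)
  simp [hx, hy]

theorem wp_copyColoring {b b' : Arr} (hb : b ≠ b') (hN : n ≤ N) (hn : σ.reg .n = n) :
    Wp N (copyColoring b b') (fun σ' => ∀ x < n, ∀ y < n, σ'.arr b' x y = σ.arr b x y) σ := by
  refine wp_forTo_forTo b' (σ.arr b) (by decide) hN rfl rfl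
    (fun σ' hf => (hf.reg .n rfl).trans hn) fun x _ y _ σ' hf hx hy _ =>
      wp_block_singleton (wp_put ?_)
  simp [hx, hy, hf.arr b (by simpa [forTo, block] using hb.symm)]

/-! ### The maximum degree -/

/-- The degree of the vertex `x` in the graph with adjacency matrix `a`. -/
def degree (n : ℕ) (a : ℕ → ℕ → ℕ) (x : ℕ) : ℕ := #{y ∈ range n | a x y = 1}

/-- The maximum degree of the graph with adjacency matrix `a`. -/
def maxDeg (n : ℕ) (a : ℕ → ℕ → ℕ) : ℕ := (range n).sup (degree n a)

theorem degree_le_maxDeg {a : ℕ → ℕ → ℕ} {x : ℕ} (hx : x < n) : degree n a x ≤ maxDeg n a :=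
  le_sup (mem_range.2 hx)

theorem maxDeg_le {a : ℕ → ℕ → ℕ} : maxDeg n a ≤ n :=
  Finset.sup_le fun _ _ => (card_filter_le _ _).trans (card_range n).le

theorem wp_countNeighbors {x : ℕ} (hN : n ≤ N) (hn : σ.reg .n = n) (hx : σ.reg .x = x)
    (hk : σ.reg .k = 0) :
    Wp N (forTo .y (.reg .n) [when (.eq (.cell .adj (.reg .x) (.reg .y)) 1)
      [.set .k (.add (.reg .k) 1)]])
      (fun σ' => σ'.reg .k = degree n (σ.arr .adj) x) σ := by
  rw [degree, ← Nat.count_eq_card_filter_range]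
  refine wp_forTo (fun k σ' => σ'.reg .k = Nat.count (fun y => σ.arr .adj x y = 1) k) hN rfl
    (fun σ' hf => (hf.reg .n rfl).trans hn) (fun _ _ _ h => h) (by simpa using hk) ?_ fun _ _ h => h
  intro y _ σ' hf hy hk
  have hx' : σ'.reg .x = x := (hf.reg .x rfl).trans hx
  have ha : σ'.arr .adj = σ.arr .adj := hf.arr .adj rfl
  rw [Nat.count_succ]
  refine wp_block_singleton (wp_when (fun hb => wp_block_singleton (wp_set ?_)) fun hb => ?_)
  · have hxy : σ.arr .adj x y = 1 := by simpa [hx', hy, ha] using hb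
    simp [hk, hxy]
  · have hxy : σ.arr .adj x y ≠ 1 := by simpa [hx', hy, ha] using hb
    simp [hk, hxy]

theorem wp_maxDegree (hN : n ≤ N) (hn : σ.reg .n = n) :
    Wp N maxDegree (fun σ' => σ'.reg .Delta = maxDeg n (σ.arr .adj)) σ := by
  refine wp_block_cons (wp_set (wp_block_singleton ?_))
  refine wp_forTo (fun k σ' => σ'.reg .Delta = (range k).sup (degree n (σ.arr .adj))) hN rfl
    (fun σ' hf => (hf.reg .n rfl).trans hn) (fun _ _ _ h => h) rfl ?_ fun _ _ h => h
  intro x _ σ₁ hf₁ hx hΔ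
  have ha : σ₁.arr .adj = σ.arr .adj := hf₁.arr .adj rfl
  have hn₁ : σ₁.reg .n = n := (hf₁.reg .n rfl).trans hn
  rw [range_add_one, sup_insert, ← hΔ, ← ha]
  refine wp_block_cons (wp_set (wp_block_cons
    ((wp_countNeighbors (σ := σ₁.setReg .k 0) hN hn₁ hx rfl).mono fun σ₂ hf₂ hk =>
      wp_block_singleton ?_)))
  have hΔ₂ : σ₂.reg .Delta = σ₁.reg .Delta := hf₂.reg .Delta rfl
  refine wp_when (fun hb => wp_block_singleton (wp_set ?_)) fun hb => ?_
  · have hlt : σ₁.reg .Delta < degree n (σ₁.arr .adj) x := by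
      simpa [hΔ₂, hk] using hb
    simpa [hk] using hlt.le
  · have hle : degree n (σ₁.arr .adj) x ≤ σ₁.reg .Delta := by
      simpa [hΔ₂, hk] using hb
    simpa [hΔ₂] using hle

end SimpleLoops

namespace RootedTree

variable {n N : ℕ} {σ σ' : Memory Reg Arr} {p : Cmd Reg Arr}
  (t : RootedTree n)

/-- The matrix `a` is the adjacency matrix of the tree `t`. -/
def IsAdjMatrix (a : ℕ → ℕ → ℕ) : Prop :=
  ∀ x < n, ∀ y < n, a x y = 1 ↔ (x ≠ t.root ∧ t.parent x = y) ∨ (y ≠ t.root ∧ t.parent y = x)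

/-- The tree `t` is the input of the algorithm, and its root is the current one. -/
structure IsInput (σ : Memory Reg Arr) : Prop where
  reg_n : σ.reg .n = n
  reg_root : σ.reg .root = t.root
  isAdjMatrix : t.IsAdjMatrix (σ.arr .adj)

/-- The labels of the vertices in `S` are known. -/
def LabelledOn (S : Set ℕ) (σ : Memory Reg Arr) : Prop :=
  ∀ z < n, (z ∈ S → σ.arr .label 0 z = t.depth z + 1) ∧ (z ∉ S → σ.arr .label 0 z = 0)

/-- The tree `t` is the input, its root is the current one, and all vertices have been labelled. -/
structure IsLabelledInput (σ : Memory Reg Arr) : Prop extends t.IsInput σ where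
  label_eq : ∀ x < n, σ.arr .label 0 x = t.depth x + 1

variable {t} {a : ℕ → ℕ → ℕ} {S : Set ℕ} {v w x : ℕ}

theorem IsAdjMatrix.mem_children_iff (h : t.IsAdjMatrix a) (hv : v < n) (hw : w < n) :
    w ∈ t.children v ↔ a v w = 1 ∧ t.depth w = t.depth v + 1 := by
  rw [h v hv w hw]
  refine ⟨fun hwv => ⟨.inr (mem_children.1 hwv).2, depth_of_mem_children hwv⟩, ?_⟩
  rintro ⟨⟨hr, rfl⟩ | hwv, hd⟩
  · have := t.depth_eq v hv hr
    omega
  · exact mem_children.2 ⟨hw, hwv⟩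

theorem IsInput.frame (h : t.IsInput σ) (hf : Frame p σ σ') (hn : p.writesReg .n = false := by rfl)
    (hr : p.writesReg .root = false := by rfl) (ha : p.writesArr .adj = false := by rfl) :
    t.IsInput σ' where
  reg_n := (hf.reg .n hn).trans h.reg_n
  reg_root := (hf.reg .root hr).trans h.reg_root
  isAdjMatrix := (hf.arr .adj ha).symm ▸ h.isAdjMatrix

theorem IsInput.congr (h : t.IsInput σ) (hn : σ'.reg .n = σ.reg .n := by rfl)
    (hr : σ'.reg .root = σ.reg .root := by rfl) (ha : σ'.arr .adj = σ.arr .adj := by rfl) :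
    t.IsInput σ' :=
  ⟨hn.trans h.reg_n, hr.trans h.reg_root, ha.symm ▸ h.isAdjMatrix⟩

theorem IsLabelledInput.frame (h : t.IsLabelledInput σ) (hf : Frame p σ σ')
    (hn : p.writesReg .n = false := by rfl) (hr : p.writesReg .root = false := by rfl)
    (ha : p.writesArr .adj = false := by rfl) (hl : p.writesArr .label = false := by rfl) :
    t.IsLabelledInput σ' where
  toIsInput := h.toIsInput.frame hf hn hr ha
  label_eq := (hf.arr .label hl).symm ▸ h.label_eq

theorem IsLabelledInput.congr (h : t.IsLabelledInput σ) (hn : σ'.reg .n = σ.reg .n := by rfl)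
    (hr : σ'.reg .root = σ.reg .root := by rfl) (ha : σ'.arr .adj = σ.arr .adj := by rfl)
    (hl : σ'.arr .label = σ.arr .label := by rfl) : t.IsLabelledInput σ' :=
  ⟨h.toIsInput.congr hn hr ha, hl.symm ▸ h.label_eq⟩

theorem LabelledOn.congr {S' : Set ℕ} (h : t.LabelledOn S σ) (hS : ∀ z < n, z ∈ S ↔ z ∈ S') :
    t.LabelledOn S' σ := fun z hz => by
  rw [← hS z hz]
  exact h z hz

/-! ### Breadth-first search -/

theorem wp_labelChildren (h : t.IsInput σ) (hN : n ≤ N) (hx : x < n) (hrx : σ.reg .x = x)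
    (hd : σ.reg .d = t.depth x) (hS : t.LabelledOn S σ)
    (hpar : x ≠ t.root → t.parent x ∈ S) :
    Wp N (forTo .y (.reg .n) [when (.and (.eq (.cell .adj (.reg .x) (.reg .y)) 1)
      (.eq (.vec .label (.reg .y)) 0)) [.putVec .label (.reg .y) (.add (.reg .d) 2)]])
      (t.LabelledOn (S ∪ t.children x)) σ := by
  refine wp_forTo_pointwise (fun σ' => σ'.arr .label 0) (fun y => if σ.arr .adj x y = 1 ∧
    σ.arr .label 0 y = 0 then t.depth x + 2 else σ.arr .label 0 y) hN rfl
    (fun σ' hf => (hf.reg .n rfl).trans h.reg_n) (fun _ _ => rfl) ?_ ?_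
  · intro y _ σ' hf hry hlab
    have hlaby : σ'.arr .label 0 y = σ.arr .label 0 y := by simp [hlab]
    have hrx' : σ'.reg .x = x := (hf.reg .x rfl).trans hrx
    have hd' : σ'.reg .d = t.depth x := (hf.reg .d rfl).trans hd
    have ha : σ'.arr .adj = σ.arr .adj := hf.arr .adj rfl
    refine wp_block_singleton (wp_when (fun hb => wp_block_singleton (wp_putVec ?_)) fun hb => ?_)
    · rw [if_pos (by simpa [hrx', hry, hlaby, ha] using hb)]
      simp [hry, hd']
    · rw [if_neg (by simpa [hrx', hry, hlaby, ha] using hb), ← hlaby, Function.update_eq_self]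
  · intro σ' _ hlab z hz
    have hadj := h.isAdjMatrix x hx z hz
    have hchild : z ∈ t.children x ↔ z ≠ t.root ∧ t.parent z = x := by simp [mem_children, hz]
    simp only [hlab, if_pos hz, Set.mem_union, mem_coe]
    by_cases hzS : z ∈ S
    · simp [(hS z hz).1 hzS, hzS]
    · have hzx : ¬ (x ≠ t.root ∧ t.parent x = z) := fun hr => hzS (hr.2 ▸ hpar hr.1)
      simp only [hadj, hzx, false_or, ← hchild, (hS z hz).2 hzS, hzS, and_true]
      exact ⟨fun hzc => by rw [if_pos hzc, depth_of_mem_children hzc], fun hzc => if_neg hzc⟩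

theorem wp_labelLevel (h : t.IsInput σ) (hN : n ≤ N) {d : ℕ} (hd : σ.reg .d = d)
    (hS : t.LabelledOn {z | t.depth z ≤ d} σ) :
    Wp N (forTo .x (.reg .n) [when (.eq (.vec .label (.reg .x)) (.add (.reg .d) 1))
      [forTo .y (.reg .n) [when (.and (.eq (.cell .adj (.reg .x) (.reg .y)) 1)
        (.eq (.vec .label (.reg .y)) 0)) [.putVec .label (.reg .y) (.add (.reg .d) 2)]]]])
      (t.LabelledOn {z | t.depth z ≤ d + 1}) σ := by
  refine wp_forTo (fun k => t.LabelledOn {z | t.depth z ≤ d ∨ t.depth z = d + 1 ∧ t.parent z < k})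
    hN rfl (fun σ' hf => (hf.reg .n rfl).trans h.reg_n) (fun _ _ _ h => h) (by simpa using hS)
    ?_ fun _ _ hI => hI.congr fun z hz => ?_
  · intro x hx σ' hf hrx hI
    have hd' : σ'.reg .d = d := (hf.reg .d rfl).trans hd
    have hlab : σ'.arr .label 0 x = d + 1 ↔ t.depth x = d := by
      by_cases hxS : t.depth x ≤ d ∨ t.depth x = d + 1 ∧ t.parent x < x
      · rw [(hI x hx).1 hxS, add_left_inj]
      · rw [(hI x hx).2 hxS]
        omega
    have hchild : ∀ z < n, t.depth z = d + 1 → (t.parent z = x ↔ z ∈ t.children x) := by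
      intro z hz hdz
      have hzr : z ≠ t.root := ne_root_of_depth_ne_zero (by omega)
      exact ⟨fun hzx => mem_children.2 ⟨hz, hzr, hzx⟩, parent_eq_of_mem_children⟩
    refine wp_block_singleton (wp_when (fun hb => wp_block_singleton ?_) fun hb => ?_)
    · have hdx : t.depth x = d := by simpa [hrx, hd', hlab] using hb
      refine (wp_labelChildren (h.frame hf) hN hx hrx (hd'.trans hdx.symm) hI fun hr => ?_).mono
        fun σ'' _ hI' => hI'.congr fun z hz => ?_
      · have := t.depth_eq x hx hr
        exact .inl (by omega)
      · have hzx := hchild z hz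
        have hdz : z ∈ t.children x → t.depth z = d + 1 := hdx ▸ depth_of_mem_children
        simp only [Set.mem_union, Set.mem_ofPred_eq, mem_coe, Nat.lt_succ_iff_lt_or_eq]
        tauto
    · have hdx : t.depth x ≠ d := by simpa [hrx, hd', hlab] using hb
      refine hI.congr fun z hz => ?_
      have hzx : t.depth z = d + 1 → t.parent z ≠ x := fun hdz hzx => by
        have := depth_of_mem_children ((hchild z hz hdz).1 hzx)
        omega
      simp only [Set.mem_ofPred_eq, Nat.lt_succ_iff_lt_or_eq]
      tauto
  · have hzn : t.depth z = d + 1 → t.parent z < n := fun hdz =>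
      t.parent_lt z hz (ne_root_of_depth_ne_zero (by omega))
    simp only [Set.mem_ofPred_eq]
    omega

theorem wp_labelVertices (h : t.IsInput σ) (hN : n ≤ N) :
    Wp N labelVertices t.IsLabelledInput σ := by
  refine wp_block_cons ((wp_fill .label 0 hN h.reg_n).mono fun σ₁ hf₁ hz => ?_)
  have h₁ : t.IsInput σ₁ := h.frame hf₁
  refine wp_block_cons (wp_putVec (wp_block_singleton ?_))
  refine wp_forTo (fun d => t.LabelledOn {z | t.depth z ≤ d}) hN rfl
    (fun σ' hf => (hf.reg .n rfl).trans h₁.reg_n) (fun _ _ _ h => h) ?_ ?_ ?_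
  · intro z hzn
    by_cases hzr : z = t.root
    · simp [h₁.reg_root, hzr, t.depth_root]
    · simp [h₁.reg_root, hzr, hz z hzn, depth_eq_zero_iff hzn]
  · exact fun d _ σ' hf hrd hI => wp_block_singleton
      (wp_labelLevel (h₁.congr.frame hf) hN hrd hI)
  · exact fun σ' hf hI => ⟨h₁.congr.frame hf, fun x hx => (hI x hx).1 (depth_lt hx).le⟩

end RootedTree

/-! ### The knapsack problem -/

section Knapsack

variable {n N c i w : ℕ} {σ σ' : Memory Reg Arr} {C S : Finset ℕ}

/-- The largest total size, at most `w`, of a set of items among the first `i` ones, where the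
items have sizes `s 0, s 1, …`: the table that dynamic programming fills in row by row. -/
def knapsack (s : ℕ → ℕ) : ℕ → ℕ → ℕ
  | 0, _ => 0
  | i + 1, w =>
    if s i ≤ w ∧ knapsack s i w < knapsack s i (w - s i) + s i then knapsack s i (w - s i) + s i
    else knapsack s i w

theorem knapsack_le (s : ℕ → ℕ) (i w : ℕ) : knapsack s i w ≤ w := by
  induction i generalizing w with
  | zero => exact Nat.zero_le w
  | succ i ih =>
    have := ih w
    have := ih (w - s i)
    rw [knapsack]
    split_ifs <;> omega

theorem sum_le_knapsack (s : ℕ → ℕ) (p : ℕ → Prop) [DecidablePred p]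
    (h : ∑ j ∈ range i with p j, s j ≤ w) : ∑ j ∈ range i with p j, s j ≤ knapsack s i w := by
  induction i generalizing w with
  | zero => simp
  | succ i ih =>
    rw [range_add_one, filter_insert] at h ⊢
    rw [knapsack]
    by_cases hp : p i
    · rw [if_pos hp, sum_insert (by simp)] at h ⊢
      have := @ih (w - s i) (by omega)
      split_ifs <;> omega
    · rw [if_neg hp] at h ⊢
      have := ih h
      split_ifs <;> omega

/-- The array `child` lists the elements of `C` without repetition. -/
def Lists (σ : Memory Reg Arr) (C : Finset ℕ) : Prop :=
  Set.BijOn (σ.arr .child 0) (range (σ.reg .count)) C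

/-- The size of the `i`-th item on the list of children. -/
def itemSize (σ : Memory Reg Arr) (i : ℕ) : ℕ := σ.arr .res 0 (σ.arr .child 0 i)

theorem Lists.card (h : Lists σ C) : σ.reg .count = #C := by
  simpa using h.finsetCard_eq

theorem Lists.insert (h : Lists σ C) (hw : w ∉ C) (hcount : σ'.reg .count = σ.reg .count + 1)
    (hchild : σ'.arr .child 0 = Function.update (σ.arr .child 0) (σ.reg .count) w) :
    Lists σ' (insert w C) := by
  have hbij : Set.BijOn (σ'.arr .child 0) (range (σ.reg .count)) C := by
    refine Set.BijOn.congr h fun i hi => ?_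
    have hne : i ≠ σ.reg .count := by simpa using (show i < σ.reg .count by simpa using hi).ne
    simp [hchild, hne]
  have hlast : σ'.arr .child 0 (σ.reg .count) = w := by simp [hchild]
  rw [Lists, hcount, range_add_one, coe_insert, coe_insert, ← hlast]
  exact hbij.insert (by simpa [hlast] using hw)

theorem Lists.sum_le_knapsack (h : Lists σ C) (hS : S ⊆ C) (hc : ∑ w ∈ S, σ.arr .res 0 w ≤ c) :
    ∑ w ∈ S, σ.arr .res 0 w ≤ knapsack (itemSize σ) (σ.reg .count) c := by
  have hsum : ∑ w ∈ S, σ.arr .res 0 w =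
      ∑ i ∈ range (σ.reg .count) with σ.arr .child 0 i ∈ S, itemSize σ i := by
    symm
    refine sum_nbij (σ.arr .child 0) (by simp) (h.injOn.mono (mod_cast filter_subset _ _))
      (fun x hx => ?_) fun _ _ => rfl
    obtain ⟨i, hi, rfl⟩ := h.surjOn (hS hx)
    exact ⟨i, by simpa using ⟨by simpa using hi, hx⟩, rfl⟩
  rw [hsum] at hc ⊢
  exact MinMaxColoring.sum_le_knapsack _ _ hc

theorem wp_solveKnapsackRow {s : ℕ → ℕ} (hc : σ.reg .c = c) (hcN : c + 1 ≤ N) (hi : σ.reg .i = i)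
    (hsize : σ.reg .size = s i) (hopt : ∀ w ≤ c, σ.arr .opt i w = knapsack s i w) :
    Wp N (forTo .w (.add (.reg .c) 1) [
      .put .opt (.add (.reg .i) 1) (.reg .w) (.cell .opt (.reg .i) (.reg .w)),
      when (.and (.le (.reg .size) (.reg .w)) (.lt (.cell .opt (.reg .i) (.reg .w))
        (.add (.cell .opt (.reg .i) (.sub (.reg .w) (.reg .size))) (.reg .size)))) [
        .put .opt (.add (.reg .i) 1) (.reg .w)
          (.add (.cell .opt (.reg .i) (.sub (.reg .w) (.reg .size))) (.reg .size))]])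
      (fun σ' => σ'.arr .opt = Function.update (σ.arr .opt) (i + 1)
        fun w => if w < c + 1 then knapsack s (i + 1) w else σ.arr .opt (i + 1) w) σ := by
  refine wp_forTo_row Arr.opt (i + 1) (knapsack s (i + 1)) hcN rfl
    (fun σ' hf => by simp [hf.reg .c rfl, hc]) ?_
  intro w hw σ₁ hf₁ hrw h₁
  have hi₁ : σ₁.reg .i = i := (hf₁.reg .i rfl).trans hi
  have hs₁ : σ₁.reg .size = s i := (hf₁.reg .size rfl).trans hsize
  have hopt₁ : ∀ w' ≤ w, σ₁.arr .opt i w' = knapsack s i w' := fun w' hw' => by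
    simp [h₁, hopt w' (by omega)]
  rw [knapsack]
  refine wp_block_cons (wp_put (wp_block_singleton (wp_when
    (fun hb => wp_block_singleton (wp_put ?_)) fun hb => ?_)))
  · rw [if_pos (by simpa [hi₁, hs₁, hrw, hopt₁] using hb)]
    simp [hi₁, hs₁, hrw, hopt₁]
  · rw [if_neg (by simpa [hi₁, hs₁, hrw, hopt₁] using hb)]
    simp [hi₁, hrw, hopt₁]

theorem wp_solveKnapsack (hc : σ.reg .c = c) (hcN : c + 1 ≤ N) (hcount : σ.reg .count ≤ N) :
    Wp N solveKnapsack (fun σ' => ∀ i ≤ σ.reg .count, ∀ w ≤ c,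
      σ'.arr .opt i w = knapsack (itemSize σ) i w) σ := by
  refine wp_block_cons ((wp_forTo_row Arr.opt 0 (fun _ => 0) hcN rfl
    (fun σ' hf => by simp [hf.reg .c rfl, hc]) fun w _ σ' _ hrw _ =>
      wp_block_singleton (wp_put (by simp [hrw]))).mono fun σ₁ hf₁ h₁ => wp_block_singleton ?_)
  have hc₁ : σ₁.reg .c = c := (hf₁.reg .c rfl).trans hc
  refine wp_forTo (fun k σ' => ∀ i ≤ k, ∀ w ≤ c, σ'.arr .opt i w = knapsack (itemSize σ) i w)
    hcount rfl (fun σ' hf => (hf.reg .count rfl).trans (hf₁.reg .count rfl)) (fun _ _ _ h => h)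
    ?_ ?_ fun _ _ h => h
  · intro i hi w hw
    simp [Nat.le_zero.1 hi, h₁, hw, knapsack]
  · intro i _ σ₂ hf₂ hri h₂
    have hsize : σ₂.arr .res 0 (σ₂.arr .child 0 i) = itemSize σ i := by
      rw [hf₂.arr .res rfl, hf₂.arr .child rfl, hf₁.arr .res rfl, hf₁.arr .child rfl, itemSize]
    refine wp_block_cons (wp_set (wp_block_singleton ((wp_solveKnapsackRow (s := itemSize σ)
      (σ := σ₂.setReg .size _) ((hf₂.reg .c rfl).trans hc₁) hcN hri (by simp [hri, hsize])
      (h₂ i le_rfl)).mono fun σ₃ _ h₃ => ?_)))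
    intro i' hi' w hw
    rw [h₃]
    obtain rfl | hne := eq_or_ne i' (i + 1)
    · simp [hw]
    · simpa [hne] using h₂ i' (by omega) w hw

/-- The vertices in `S` are marked. -/
def MarkedOn (n : ℕ) (S : Set ℕ) (σ : Memory Reg Arr) : Prop :=
  ∀ x < n, σ.arr .mark 0 x = 1 ↔ x ∈ S

theorem MarkedOn.congr {Z Z' : Set ℕ} (h : MarkedOn n Z σ) (hZ : ∀ x < n, x ∈ Z ↔ x ∈ Z') :
    MarkedOn n Z' σ := fun x hx => (h x hx).trans (hZ x hx)

/-- The marked vertices belong to an optimal solution of the knapsack problem with the items `C`,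
and this solution can be completed with the first `i` items on the list. The register `w` holds
the capacity left to them. -/
def PartlyMarked (n c : ℕ) (σ : Memory Reg Arr) (C : Finset ℕ) (i : ℕ) (σ' : Memory Reg Arr) :
    Prop :=
  σ'.reg .w ≤ c ∧ ∃ S ⊆ C, MarkedOn n S σ' ∧ (∀ k < i, σ.arr .child 0 k ∉ S) ∧
    ∑ w ∈ S, σ.arr .res 0 w + knapsack (itemSize σ) i (σ'.reg .w) =
      knapsack (itemSize σ) (σ.reg .count) c

theorem wp_markItem (hC : Lists σ C) (hi : i < σ.reg .count) (hri : σ'.reg .i = i)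
    (hchild : σ'.arr .child = σ.arr .child) (hres : σ'.arr .res = σ.arr .res)
    (hopt : ∀ i ≤ σ.reg .count, ∀ w ≤ c, σ'.arr .opt i w = knapsack (itemSize σ) i w)
    (h : PartlyMarked n c σ C (i + 1) σ') :
    Wp N (when (.lt (.cell .opt (.reg .i) (.reg .w)) (.cell .opt (.add (.reg .i) 1) (.reg .w)))
      [.putVec .mark (.vec .child (.reg .i)) 1,
        .set .w (.sub (.reg .w) (.vec .res (.vec .child (.reg .i))))])
      (PartlyMarked n c σ C i) σ' := by
  obtain ⟨hw, S, hSC, hmark, hnot, hsum⟩ := h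
  have ho := hopt i hi.le _ hw
  have ho' := hopt (i + 1) hi _ hw
  rw [knapsack] at ho' hsum
  refine wp_when (fun hb => wp_block_cons (wp_putVec (wp_block_singleton (wp_set ?_)))) fun hb => ?_
  · have hlt : σ'.arr .opt i (σ'.reg .w) < σ'.arr .opt (i + 1) (σ'.reg .w) := by
      simpa [hri] using hb
    have hcond : itemSize σ i ≤ σ'.reg .w ∧ knapsack (itemSize σ) i (σ'.reg .w) <
        knapsack (itemSize σ) i (σ'.reg .w - itemSize σ i) + itemSize σ i := by
      by_contra hcond
      rw [if_neg hcond] at ho'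
      omega
    rw [if_pos hcond] at hsum
    have hsize : σ.arr .res 0 (σ.arr .child 0 i) = itemSize σ i := rfl
    refine ⟨by simpa using hw.trans' (Nat.sub_le _ _), insert (σ.arr .child 0 i) S,
      insert_subset_iff.2 ⟨hC.mapsTo (by simpa using hi), hSC⟩, fun x hx => ?_, fun k hk => ?_, ?_⟩
    · obtain rfl | hne := eq_or_ne x (σ.arr .child 0 i)
      · simp [hri, hchild]
      · simpa [hri, hchild, hne] using hmark x hx
    · have := hC.injOn.ne (x := k) (y := i) (by simpa using hk.trans hi) (by simpa using hi) hk.ne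
      simp [this, hnot k (by omega)]
    · rw [sum_insert (hnot i i.lt_succ_self), ← hsum, hsize, add_comm (itemSize σ i), add_assoc,
        add_comm (itemSize σ i)]
      simp [hri, hchild, hres, hsize]
  · have hle : σ'.arr .opt (i + 1) (σ'.reg .w) ≤ σ'.arr .opt i (σ'.reg .w) := by
      simpa [hri] using hb
    refine ⟨hw, S, hSC, hmark, fun k hk => hnot k (by omega), ?_⟩
    rw [← hsum]
    split_ifs at ho' ⊢ <;> omega

theorem wp_markSolution (hN : n ≤ N) (hn : σ.reg .n = n) (hc : σ.reg .c = c)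
    (hcount : σ.reg .count ≤ N) (hC : Lists σ C)
    (hopt : ∀ i ≤ σ.reg .count, ∀ w ≤ c, σ.arr .opt i w = knapsack (itemSize σ) i w) :
    Wp N markSolution (fun σ' => ∃ S ⊆ C, MarkedOn n S σ' ∧
      ∑ w ∈ S, σ.arr .res 0 w = knapsack (itemSize σ) (σ.reg .count) c) σ := by
  refine wp_block_cons ((wp_fill .mark 0 hN hn).mono fun σ₁ hf₁ hz =>
    wp_block_cons (wp_set (wp_block_singleton ?_)))
  have hc₁ : σ₁.reg .c = c := (hf₁.reg .c rfl).trans hc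
  refine wp_forTo (fun j => PartlyMarked n c σ C (σ.reg .count - j)) hcount rfl
    (fun σ' hf => (hf.reg .count rfl).trans (hf₁.reg .count rfl)) (fun _ _ _ h => h) ?_ ?_ ?_
  · exact ⟨by simp [hc₁], ∅, by simp, fun x hx => by simp [hz x hx], by simp, by simp [hc₁]⟩
  · intro j hj σ₂ hf₂ hrj h₂
    have hcount₂ : σ₂.reg .count = σ.reg .count := (hf₂.reg .count rfl).trans (hf₁.reg .count rfl)
    refine wp_block_cons (wp_set (wp_block_singleton (wp_markItem hC (by omega) ?_
      ((hf₂.arr .child rfl).trans (hf₁.arr .child rfl))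
      ((hf₂.arr .res rfl).trans (hf₁.arr .res rfl)) ?_ ?_)))
    · simp [hcount₂, hrj]
    · have ho : σ₂.arr .opt = σ.arr .opt := (hf₂.arr .opt rfl).trans (hf₁.arr .opt rfl)
      simpa [ho] using hopt
    · have : σ.reg .count - (j + 1) + 1 = σ.reg .count - j := by omega
      rw [this]
      exact h₂
  · rintro σ' - ⟨-, S, hSC, hmark, -, hsum⟩
    exact ⟨S, hSC, hmark, by simpa [knapsack] using hsum⟩

end Knapsack

/-! ### Listing children and marking descendants -/

namespace RootedTree

variable {n N v x : ℕ} {t : RootedTree n} {σ : Memory Reg Arr} {S : Set ℕ}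

theorem wp_listChildren (h : t.IsLabelledInput σ) (hN : n ≤ N) (hv : v < n)
    (hrv : σ.reg .v = v) (hd : σ.reg .d = t.depth v + 1) :
    Wp N listChildren (fun σ' => Lists σ' (t.children v) ∧
      σ'.reg .total = ∑ w ∈ t.children v, σ.arr .res 0 w) σ := by
  refine wp_block_cons (wp_set (wp_block_cons (wp_set (wp_block_singleton ?_))))
  refine wp_forTo (fun k σ' => Lists σ' {w ∈ range k | w ∈ t.children v} ∧
    σ'.reg .total = ∑ w ∈ range k with w ∈ t.children v, σ.arr .res 0 w) hN rfl
    (fun σ' hf => (hf.reg .n rfl).trans h.reg_n) (fun _ _ _ h => h) ⟨by simp [Lists], by simp⟩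
    ?_ fun σ' _ hI => ?_
  · rintro w hw σ' hf hrw ⟨hlist, htotal⟩
    have h' : t.IsLabelledInput σ' := h.congr.frame hf
    have hrv' : σ'.reg .v = v := (hf.reg .v rfl).trans hrv
    have hd' : σ'.reg .d = t.depth v + 1 := (hf.reg .d rfl).trans hd
    have hres : σ'.arr .res = σ.arr .res := hf.arr .res rfl
    have hmem : w ∈ t.children v ↔ σ'.arr .adj v w = 1 ∧ t.depth w = t.depth v + 1 :=
      h'.isAdjMatrix.mem_children_iff hv hw
    have hlabel := h'.label_eq w hw
    rw [range_add_one, filter_insert]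
    refine wp_block_singleton (wp_when (fun hb => wp_block_cons (wp_putVec (wp_block_cons
      (wp_set (wp_block_singleton (wp_set ?_)))))) fun hb => ?_)
    · rw [if_pos (by simpa [hrv', hrw, hd', hlabel, hmem] using hb)]
      exact ⟨hlist.insert (by simp) (by simp) (by simp [hrw]), by
        simp [htotal, hrw, hres, add_comm]⟩
    · rw [if_neg (by simpa [hrv', hrw, hd', hlabel, hmem] using hb)]
      exact ⟨hlist, htotal⟩
  · have hchildren : {w ∈ range n | w ∈ t.children v} = t.children v :=
      filter_mem_eq_inter.trans (inter_eq_right.2 fun w hw => mem_range.2 (lt_of_mem_children hw))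
    rwa [hchildren] at hI

theorem wp_markChildren {j : ℕ} (h : t.IsLabelledInput σ) (hN : n ≤ N) (hx : x < n)
    (hrx : σ.reg .x = x) (hj : σ.reg .j = j) (hdx : t.depth x + 1 = j) (hS : MarkedOn n S σ) :
    Wp N (forTo .y (.reg .n) [when (.and (.eq (.cell .adj (.reg .x) (.reg .y)) 1)
      (.eq (.vec .label (.reg .y)) (.add (.reg .j) 1))) [.putVec .mark (.reg .y) 1]])
      (MarkedOn n (S ∪ t.children x)) σ := by
  refine wp_forTo_pointwise (fun σ' => σ'.arr .mark 0)
    (fun y => if y ∈ t.children x then 1 else σ.arr .mark 0 y) hN rfl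
    (fun σ' hf => (hf.reg .n rfl).trans h.reg_n) (fun _ _ => rfl) ?_ fun σ' _ hmark z hz => ?_
  · intro y hy σ' hf hry hmark
    have h' : t.IsLabelledInput σ' := h.frame hf
    have hmarky : σ'.arr .mark 0 y = σ.arr .mark 0 y := by simp [hmark]
    have hrx' : σ'.reg .x = x := (hf.reg .x rfl).trans hrx
    have hj' : σ'.reg .j = t.depth x + 1 := (hf.reg .j rfl).trans (hj.trans hdx.symm)
    have hmem : y ∈ t.children x ↔ σ'.arr .adj x y = 1 ∧ t.depth y = t.depth x + 1 :=
      h'.isAdjMatrix.mem_children_iff hx hy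
    have hlabel := h'.label_eq y hy
    refine wp_block_singleton (wp_when (fun hb => wp_block_singleton (wp_putVec ?_)) fun hb => ?_)
    · rw [if_pos (by simpa [hrx', hry, hj', hlabel, hmem] using hb)]
      simp [hry]
    · rw [if_neg (by simpa [hrx', hry, hj', hlabel, hmem] using hb), ← hmarky,
        Function.update_eq_self]
  · by_cases hzc : z ∈ t.children x <;> simp [hmark, hz, hzc, hS z hz]

/-- The vertices marked in round `j` before the turn of `x`: those in `S` and their descendants of
depth less than `j`, or of depth `j` and with a parent less than `x`. -/
def markedBefore (t : RootedTree n) (S : Set ℕ) (j x : ℕ) : Set ℕ :=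
  {z | z ∈ S ∨ t.Below S z ∧ (t.depth z < j ∨ t.depth z = j ∧ z ≠ t.root ∧ t.parent z < x)}

theorem wp_markVertex {j : ℕ} (h : t.IsLabelledInput σ) (hN : n ≤ N) (hj : σ.reg .j = j)
    (hx : x < n) (hrx : σ.reg .x = x) (hI : MarkedOn n (t.markedBefore S j x) σ) :
    Wp N (when (.and (.eq (.vec .label (.reg .x)) (.reg .j)) (.eq (.vec .mark (.reg .x)) 1))
      [forTo .y (.reg .n) [when (.and (.eq (.cell .adj (.reg .x) (.reg .y)) 1)
        (.eq (.vec .label (.reg .y)) (.add (.reg .j) 1))) [.putVec .mark (.reg .y) 1]]])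
      (MarkedOn n (t.markedBefore S j (x + 1))) σ := by
  unfold markedBefore at hI ⊢
  have hmark : t.depth x + 1 = j → (σ.arr .mark 0 x = 1 ↔ t.Below S x) := by
    refine fun hdx => (hI x hx).trans ?_
    have hbase : x ∈ S → t.Below S x := .base hx
    simp only [Set.mem_ofPred_eq, show t.depth x < j by omega, true_or, and_true]
    grind
  have hlabel := h.label_eq x hx
  refine wp_when (fun hb => wp_block_singleton ?_) fun hb => ?_
  · obtain ⟨hdx, hmarkx⟩ : t.depth x + 1 = j ∧ σ.arr .mark 0 x = 1 := by
      simpa [hrx, hj, hlabel] using hb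
    refine (wp_markChildren h hN hx hrx hj hdx hI).mono fun _ _ hI' => hI'.congr fun z hz => ?_
    have hchild : z ≠ t.root → t.parent z = x → t.Below S z ∧ t.depth z = j := by
      rintro hzr rfl
      exact ⟨.step hz hzr ((hmark hdx).1 hmarkx), (t.depth_eq z hz hzr).trans hdx⟩
    simp only [Set.mem_union, Set.mem_ofPred_eq, mem_coe, mem_children, hz, true_and,
      Nat.lt_succ_iff_lt_or_eq]
    grind
  · have hmarkx : t.depth x + 1 = j → σ.arr .mark 0 x ≠ 1 := by
      simpa [hrx, hj, hlabel] using hb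
    refine hI.congr fun z hz => ?_
    have hchild : t.Below S z → t.depth z = j → z ≠ t.root → t.parent z = x → z ∈ S := by
      rintro hzS hzj hzr rfl
      have hdx := (t.depth_eq z hz hzr).symm.trans hzj
      have hpar := mt (hmark hdx).2 (hmarkx hdx)
      exact ((below_iff hz).1 hzS).resolve_right fun h => hpar h.2
    simp only [Set.mem_ofPred_eq]
    grind

theorem wp_markLevel {j : ℕ} (h : t.IsLabelledInput σ) (hN : n ≤ N) (hj : σ.reg .j = j)
    (hS : MarkedOn n {z | z ∈ S ∨ t.Below S z ∧ t.depth z < j} σ) :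
    Wp N (forTo .x (.reg .n) [when (.and (.eq (.vec .label (.reg .x)) (.reg .j))
      (.eq (.vec .mark (.reg .x)) 1)) [forTo .y (.reg .n) [when (.and
        (.eq (.cell .adj (.reg .x) (.reg .y)) 1) (.eq (.vec .label (.reg .y)) (.add (.reg .j) 1)))
          [.putVec .mark (.reg .y) 1]]]])
      (MarkedOn n {z | z ∈ S ∨ t.Below S z ∧ t.depth z < j + 1}) σ := by
  refine wp_forTo (fun k => MarkedOn n (t.markedBefore S j k)) hN rfl
    (fun σ' hf => (hf.reg .n rfl).trans h.reg_n) (fun _ _ _ h => h)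
    (by simpa [markedBefore] using hS) (fun x hx σ' hf hrx hI => wp_block_singleton
      (wp_markVertex (h.frame hf) hN ((hf.reg .j rfl).trans hj) hx hrx hI))
    fun σ' _ hI => hI.congr fun z hz => ?_
  have hpar := t.parent_lt z hz
  have hroot : t.Below S z → z = t.root → z ∈ S := by
    rintro hzS rfl
    exact ((below_iff hz).1 hzS).resolve_right fun h => h.1 rfl
  simp only [markedBefore, Set.mem_ofPred_eq]
  grind

theorem wp_markSuccessors (h : t.IsLabelledInput σ) (hN : n ≤ N) (hS : MarkedOn n S σ) :
    Wp N markSuccessors (MarkedOn n {x | t.Below S x}) σ := by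
  refine wp_forTo (fun j => MarkedOn n {z | z ∈ S ∨ t.Below S z ∧ t.depth z < j}) hN rfl
    (fun σ' hf => (hf.reg .n rfl).trans h.reg_n) (fun _ _ _ h => h) (by simpa using hS)
    (fun j _ σ' hf hrj hI => wp_block_singleton (wp_markLevel (h.frame hf) hN hrj hI))
    fun σ' _ hI => hI.congr fun z hz => ?_
  have hbase : z ∈ S → t.Below S z := .base hz
  have hdepth := t.depth_lt hz
  simp only [Set.mem_ofPred_eq]
  tauto

end RootedTree

/-! ### Coloring edges -/

namespace RootedTree

variable {n N K : ℕ} (t : RootedTree n)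

/-- The edge whose lower end is `z` joins `x` and `y`. -/
def Joins (z x y : ℕ) : Prop := (z = x ∧ t.parent z = y) ∨ (z = y ∧ t.parent z = x)

/-- The matrix `m` stores the edge coloring `f`. -/
def Represents (m : ℕ → ℕ → ℕ) (f : ℕ → ℕ) : Prop :=
  ∀ z < n, z ≠ t.root → ∀ x y, t.Joins z x y → m x y = f z

variable {t} {z w x y : ℕ} {f g : ℕ → ℕ} {m m' a : ℕ → ℕ → ℕ} {S : Set ℕ}
  {p q : ℕ → Prop} {σ : Memory Reg Arr}

theorem Joins.iff {x' y' : ℕ} (h : t.Joins z x y) :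
    t.Joins z x' y' ↔ (x' = x ∧ y' = y) ∨ (x' = y ∧ y' = x) := by
  unfold Joins at h ⊢
  grind

theorem Joins.lt (h : t.Joins z x y) (hz : z < n) (hr : z ≠ t.root) : x < n ∧ y < n := by
  have hpar := t.parent_lt z hz hr
  rcases h with ⟨rfl, rfl⟩ | ⟨rfl, rfl⟩
  exacts [⟨hz, hpar⟩, ⟨hpar, hz⟩]

theorem Joins.unique (h : t.Joins z x y) (hz : z < n) (hzr : z ≠ t.root) (hw : w < n)
    (hwr : w ≠ t.root) (h' : t.Joins w x y) : z = w := by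
  have hdz := t.depth_eq z hz hzr
  have hdw := t.depth_eq w hw hwr
  unfold Joins at h h'
  grind

theorem IsAdjMatrix.eq_one_iff (h : t.IsAdjMatrix a) (hx : x < n) (hy : y < n) :
    a x y = 1 ↔ ∃ z < n, z ≠ t.root ∧ t.Joins z x y := by
  rw [h x hx y hy]
  unfold Joins
  grind

theorem Represents.congr (h : t.Represents m f) (hf : ∀ z < n, z ≠ t.root → f z = g z) :
    t.Represents m g := fun z hz hr x y hxy => (h z hz hr x y hxy).trans (hf z hz hr)

theorem Represents.congr_matrix (h : t.Represents m f)
    (hm : ∀ x < n, ∀ y < n, m' x y = m x y) : t.Represents m' f := by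
  intro z hz hr x y hxy
  obtain ⟨hx, hy⟩ := hxy.lt hz hr
  rw [hm x hx y hy, h z hz hr x y hxy]

open Classical in
theorem Represents.update (h : t.Represents m f) (hz : z < n) (hr : z ≠ t.root)
    (hm : ∀ x y, m' x y = if t.Joins z x y then K else m x y) :
    t.Represents m' (Function.update f z K) := by
  intro w hw hwr x y hxy
  rw [hm, Function.update_apply, h w hw hwr x y hxy]
  refine if_congr ⟨fun h => (h.unique hz hr hw hwr hxy).symm, ?_⟩ rfl rfl
  rintro rfl
  exact hxy

theorem paint_paint : paint (paint f p K) q K = paint f (fun z => p z ∨ q z) K := by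
  ext z
  unfold paint
  grind

theorem paint_eq_self (h : ¬ p z) : paint f p K z = f z := if_neg fun h' => h h'.2

theorem paint_congr (h : p z ↔ q z) : paint f p K z = paint f q K z := by
  classical exact if_congr (and_congr_right' h) rfl rfl

theorem wp_colorEdge (h : t.IsInput σ) (hf : t.Represents (σ.arr .cur) f) (hx : x < n)
    (hy : y < n) (hrx : σ.reg .x = x) (hry : σ.reg .y = y) (hK : σ.reg .color = K) :
    Wp N (when (.and (.eq (.cell .adj (.reg .x) (.reg .y)) 1)
      (.eq (.cell .cur (.reg .x) (.reg .y)) 0))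
      [.put .cur (.reg .x) (.reg .y) (.reg .color), .put .cur (.reg .y) (.reg .x) (.reg .color)])
      (fun σ' => t.Represents (σ'.arr .cur) (paint f (t.Joins · x y) K)) σ := by
  have hadj := h.isAdjMatrix.eq_one_iff hx hy
  refine wp_when (fun hb => wp_block_cons (wp_put (wp_block_singleton (wp_put ?_)))) fun hb => ?_
  · obtain ⟨hxy, hcur⟩ : σ.arr .adj x y = 1 ∧ σ.arr .cur x y = 0 := by simpa [hrx, hry] using hb
    obtain ⟨z, hz, hr, hzxy⟩ := hadj.1 hxy
    refine (hf.update (K := K) hz hr fun x' y' => ?_).congr fun w hw hwr => ?_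
    · simp only [hzxy.iff, Memory.reg_setCell, Memory.arr_setCell, Exp.eval, hrx, hry, hK,
        Function.update_self, Function.update_apply]
      grind
    · have hunique : t.Joins w x y → w = z := fun h => h.unique hw hwr hz hr hzxy
      have hfz : f z = 0 := (hf z hz hr x y hzxy).symm.trans hcur
      unfold paint
      grind
  · have hcur : σ.arr .adj x y = 1 → σ.arr .cur x y ≠ 0 := by simpa [hrx, hry] using hb
    refine hf.congr fun z hz hr => (if_neg ?_).symm
    rintro ⟨hfz, hzxy⟩
    exact hcur (hadj.2 ⟨z, hz, hr, hzxy⟩) ((hf z hz hr x y hzxy).trans hfz)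

theorem wp_colorIncidentEdges (h : t.IsInput σ) (hN : n ≤ N) (hf : t.Represents (σ.arr .cur) f)
    (hx : x < n) (hrx : σ.reg .x = x) (hK : σ.reg .color = K) :
    Wp N (forTo .y (.reg .n) [when (.and (.eq (.cell .adj (.reg .x) (.reg .y)) 1)
      (.eq (.cell .cur (.reg .x) (.reg .y)) 0))
      [.put .cur (.reg .x) (.reg .y) (.reg .color), .put .cur (.reg .y) (.reg .x) (.reg .color)]])
      (fun σ' => t.Represents (σ'.arr .cur) (paint f (fun z => ∃ y < n, t.Joins z x y) K)) σ := by
  refine wp_forTo (fun k σ' => t.Represents (σ'.arr .cur)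
    (paint f (fun z => ∃ y < k, t.Joins z x y) K)) hN rfl
    (fun σ' hf' => (hf'.reg .n rfl).trans h.reg_n) (fun _ _ _ h => h)
    (hf.congr fun z _ _ => (paint_eq_self (by simp)).symm)
    (fun y hy σ' hf' hry hI => wp_block_singleton
      ((wp_colorEdge (h.frame hf') hI hx hy ((hf'.reg .x rfl).trans hrx) hry
        ((hf'.reg .color rfl).trans hK)).mono fun _ _ hI' => ?_)) fun _ _ h => h
  rw [paint_paint] at hI'
  exact hI'.congr fun z _ _ => paint_congr Nat.exists_lt_succ_right.symm

theorem exists_joins_of_below_iff (hz : z < n) (hr : z ≠ t.root) :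
    (∃ x < n, t.Below S x ∧ ∃ y < n, t.Joins z x y) ↔ t.Below S z := by
  refine ⟨?_, fun h => ⟨z, hz, h, t.parent z, t.parent_lt z hz hr, .inl ⟨rfl, rfl⟩⟩⟩
  rintro ⟨x, -, hx, y, -, ⟨rfl, -⟩ | ⟨-, rfl⟩⟩
  exacts [hx, .step hz hr hx]

theorem wp_colorMarked (h : t.IsInput σ) (hN : n ≤ N) (hS : MarkedOn n {x | t.Below S x} σ)
    (hf : t.Represents (σ.arr .cur) f) (hK : σ.reg .color + 1 = K) :
    Wp N colorMarked (fun σ' => σ'.reg .color = K ∧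
      t.Represents (σ'.arr .cur) (t.recolor f S K)) σ := by
  refine wp_block_cons (wp_set (wp_block_singleton ?_))
  refine wp_forTo (fun k σ' => t.Represents (σ'.arr .cur)
    (paint f (fun z => ∃ x < k, t.Below S x ∧ ∃ y < n, t.Joins z x y) K)) hN rfl
    (fun σ' hf' => (hf'.reg .n rfl).trans h.reg_n) (fun _ _ _ h => h)
    (hf.congr fun z _ _ => (paint_eq_self (by simp)).symm) ?_ fun σ' hf' hI => ⟨?_, ?_⟩
  · intro x hx σ' hf' hrx hI
    have hmark : σ'.arr .mark 0 x = 1 ↔ t.Below S x := by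
      rw [hf'.arr .mark rfl]
      exact hS x hx
    refine wp_block_singleton (wp_when (fun hb => wp_block_singleton
      ((wp_colorIncidentEdges (h.congr.frame hf') hN hI hx hrx
        ((hf'.reg .color rfl).trans (by simpa using hK))).mono fun _ _ hI' => ?_)) fun hb => ?_)
    · have hxS : t.Below S x := hmark.1 (by simpa [hrx] using hb)
      rw [paint_paint] at hI'
      refine hI'.congr fun z _ _ => paint_congr ?_
      simp only [Nat.lt_succ_iff_lt_or_eq]
      grind
    · have hxS : ¬ t.Below S x := mt hmark.2 (by simpa [hrx] using hb)
      refine hI.congr fun z _ _ => paint_congr ?_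
      simp only [Nat.lt_succ_iff_lt_or_eq]
      grind
  · rw [hf'.reg .color rfl]
    simpa using hK
  · exact hI.congr fun z hz hr => paint_congr (exists_joins_of_below_iff hz hr)

theorem wp_colorUncolored (hN : n ≤ N) (hn : σ.reg .n = n) :
    Wp N (forTo .x (.reg .n) [forTo .y (.reg .n) [
      when (.and (.eq (.cell .adj (.reg .x) (.reg .y)) 1) (.eq (.cell .cur (.reg .x) (.reg .y)) 0))
        [.put .cur (.reg .x) (.reg .y) (.reg .color)]]])
      (fun σ' => ∀ x < n, ∀ y < n, σ'.arr .cur x y =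
        if σ.arr .adj x y = 1 ∧ σ.arr .cur x y = 0 then σ.reg .color else σ.arr .cur x y) σ := by
  refine wp_forTo_forTo Arr.cur (fun x y => if σ.arr .adj x y = 1 ∧ σ.arr .cur x y = 0
    then σ.reg .color else σ.arr .cur x y) (by decide) hN rfl rfl
    (fun σ' hf => (hf.reg .n rfl).trans hn) fun x _ y _ σ' hf hrx hry hcur => ?_
  rw [← hcur, ← hf.arr .adj rfl, ← hf.reg .color rfl]
  refine wp_block_singleton (wp_when (fun hb => wp_block_singleton (wp_put ?_)) fun hb => ?_)
  · rw [if_pos (by simpa [hrx, hry] using hb)]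
    simp [hrx, hry]
  · rw [if_neg (by simpa [hrx, hry] using hb)]
    simp

theorem wp_colorRemaining (h : t.IsInput σ) (hN : n ≤ N) (hf : t.Represents (σ.arr .cur) f)
    (hK : σ.reg .color + 1 = K) :
    Wp N colorRemaining (fun σ' => t.Represents (σ'.arr .cur)
      fun z => if f z = 0 then K else f z) σ := by
  refine wp_block_cons (wp_set (wp_block_singleton
    ((wp_colorUncolored (σ := σ.setReg .color (σ.reg .color + 1)) hN h.reg_n).mono
      fun σ' _ hcur z hz hr x y hxy => ?_)))
  obtain ⟨hx, hy⟩ := hxy.lt hz hr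
  have hadj : σ.arr .adj x y = 1 := (h.isAdjMatrix.eq_one_iff hx hy).2 ⟨z, hz, hr, hxy⟩
  simp [hcur x hx y hy, hf z hz hr x y hxy, hadj, hK]

end RootedTree

/-! ### Testing a candidate -/

namespace RootedTree

variable {n N K c v : ℕ} {t : RootedTree n} {f : ℕ → ℕ} {P P' : Set ℕ} {C : Finset ℕ}
  {σ σ' : Memory Reg Arr}

/-- What is known during a test of the candidate `c` when the vertices in `P` have been treated:
the residual numbers are at most what any solution needs, which moreover excludes a failure, and
without a failure there is a partial solution. -/
structure TestInv (t : RootedTree n) (c : ℕ) (P : Set ℕ) (σ : Memory Reg Arr) : Prop where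
  complete : ∀ f, t.IsSolution c f → σ.reg .ok = 1 ∧
    ∀ x < n, σ.arr .res 0 x ≤ #(t.colorClassBelow f (f x) x)
  sound : σ.reg .ok = 1 → ∃ col, t.PartialSolution c P (σ.arr .res 0) col ∧
    t.Represents (σ.arr .cur) col ∧ ∀ x < n, col x ≤ σ.reg .color

theorem TestInv.congr (h : t.TestInv c P σ) (hok : σ'.reg .ok = σ.reg .ok := by rfl)
    (hcolor : σ'.reg .color = σ.reg .color := by rfl)
    (hres : σ'.arr .res = σ.arr .res := by rfl) (hcur : σ'.arr .cur = σ.arr .cur := by rfl) :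
    t.TestInv c P σ' where
  complete := by
    rw [hok, hres]
    exact h.complete
  sound := by
    rw [hok, hres, hcolor, hcur]
    exact h.sound

theorem TestInv.of_failed (h : t.TestInv c P σ) (hok : σ.reg .ok ≠ 1) : t.TestInv c P' σ :=
  ⟨h.complete, fun h => absurd h hok⟩

theorem TestInv.insert_leaf (h : t.TestInv c P σ) (hok : σ.reg .ok = 1) (hv : v < n)
    (hvP : v ∉ P) (hC : t.children v = ∅) : t.TestInv c (insert v P) σ := by
  obtain ⟨col, hcol, hcur, hlt⟩ := h.sound hok
  refine ⟨h.complete, fun _ => ⟨col, ?_, hcur, hlt⟩⟩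
  have hrecolor : t.recolor col ∅ (σ.reg .color + 1) = col :=
    funext fun x => recolor_of_not_below fun hb => by simpa using hb.exists_mem
  simpa [hC, hrecolor] using hcol.treat (S := ∅) (K := σ.reg .color + 1) hv hvP (by simp [hC])
    (empty_subset _) (by simp) (by simp) (fun x hx => ((hlt x hx).trans_lt (Nat.lt_succ_self _)).ne)
    (by simpa [hC] using hcol.res_le v hv)

theorem TestInv.residual_le (h : t.TestInv c P σ) (hok : σ.reg .ok = 1) (hv : v < n)
    (hvP : v ∉ P) (hC : Lists σ (t.children v)) (hf : t.IsSolution c f) :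
    (∑ w ∈ t.children v, σ.arr .res 0 w - knapsack (itemSize σ) (σ.reg .count) c) +
      σ.arr .res 0 v ≤ #(t.colorClassBelow f (f v) v) := by
  obtain ⟨col, hcol, -⟩ := h.sound hok
  exact hf.residual_le (fun w hw => (h.complete f hf).2 w (lt_of_mem_children hw)) hv
    (hcol.res_of_notMem v hv hvP) fun S hS hc => hC.sum_le_knapsack hS hc

theorem wp_colorSolution (h : t.IsLabelledInput σ) (hN : n ≤ N) (hc : σ.reg .c = c)
    (hrv : σ.reg .v = v) (hcount : σ.reg .count ≤ N) (hC : Lists σ C)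
    (hopt : ∀ i ≤ σ.reg .count, ∀ w ≤ c, σ.arr .opt i w = knapsack (itemSize σ) i w)
    (hf : t.Represents (σ.arr .cur) f) (hK : σ.reg .color + 1 = K) :
    Wp N (block [markSolution, markSuccessors, colorMarked, .putVec .res (.reg .v)
      (.add (.vec .res (.reg .v)) (.sub (.reg .total) (.cell .opt (.reg .count) (.reg .c))))])
      (fun σ' => ∃ S ⊆ C, ∑ w ∈ S, σ.arr .res 0 w = knapsack (itemSize σ) (σ.reg .count) c ∧
        σ'.reg .color = K ∧ t.Represents (σ'.arr .cur) (t.recolor f S K) ∧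
        σ'.arr .res 0 = Function.update (σ.arr .res 0) v (σ.arr .res 0 v +
          (σ.reg .total - knapsack (itemSize σ) (σ.reg .count) c))) σ := by
  refine wp_block_cons ((wp_markSolution hN h.reg_n hc hcount hC hopt).mono ?_)
  rintro σ₁ hf₁ ⟨S, hS, hmark, hsum⟩
  refine wp_block_cons ((wp_markSuccessors (h.frame hf₁) hN hmark).mono fun σ₂ hf₂ hmark₂ => ?_)
  have hcur₂ : σ₂.arr .cur = σ.arr .cur := (hf₂.arr .cur rfl).trans (hf₁.arr .cur rfl)
  have hcolor₂ : σ₂.reg .color = σ.reg .color := (hf₂.reg .color rfl).trans (hf₁.reg .color rfl)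
  refine wp_block_cons ((wp_colorMarked ((h.frame hf₁).frame hf₂).toIsInput hN hmark₂
    (hcur₂ ▸ hf) (hcolor₂ ▸ hK)).mono ?_)
  rintro σ₃ hf₃ ⟨hcolor₃, hcur₃⟩
  refine wp_block_singleton (wp_putVec ⟨S, hS, hsum, hcolor₃, by simpa using hcur₃, ?_⟩)
  have hf₄ : Frame (.seq markSolution (.seq markSuccessors colorMarked)) σ σ₃ :=
    hf₁.seq_left.trans (hf₂.seq_left.trans hf₃.seq_right).seq_right
  simp [← hopt _ le_rfl c le_rfl, hf₄.reg .v rfl, hf₄.reg .total rfl, hf₄.reg .count rfl,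
    hf₄.reg .c rfl, hf₄.arr .res rfl, hf₄.arr .opt rfl, hrv, hc]

theorem wp_testResidual (h : t.IsLabelledInput σ) (hN : n ≤ N) (hc : σ.reg .c = c)
    (hok : σ.reg .ok = 1) (hv : v < n) (hrv : σ.reg .v = v) (hvP : v ∉ P)
    (hch : ∀ w ∈ t.children v, w ∈ P) (hI : t.TestInv c P σ) (hcount : σ.reg .count ≤ N)
    (hC : Lists σ (t.children v)) (htotal : σ.reg .total = ∑ w ∈ t.children v, σ.arr .res 0 w)
    (hopt : ∀ i ≤ σ.reg .count, ∀ w ≤ c, σ.arr .opt i w = knapsack (itemSize σ) i w) :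
    Wp N (.ite (.lt (.reg .c) (.add (.sub (.reg .total) (.cell .opt (.reg .count) (.reg .c)))
      (.vec .res (.reg .v)))) (.set .ok 0) (block [markSolution, markSuccessors, colorMarked,
      .putVec .res (.reg .v) (.add (.vec .res (.reg .v))
        (.sub (.reg .total) (.cell .opt (.reg .count) (.reg .c))))]))
      (t.TestInv c (insert v P)) σ := by
  obtain ⟨col, hcol, hcur, hlt⟩ := hI.sound hok
  let R := ∑ w ∈ t.children v, σ.arr .res 0 w - knapsack (itemSize σ) (σ.reg .count) c
  have hle : ∀ f, t.IsSolution c f → R + σ.arr .res 0 v ≤ #(t.colorClassBelow f (f v) v) :=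
    fun f hf => hI.residual_le hok hv hvP hC hf
  refine wp_ite (fun hb => wp_set ⟨fun f hf => ?_, fun h => by simp at h⟩) fun hb => ?_
  · have hfail : c < R + σ.arr .res 0 v := by simpa [hrv, hc, htotal, hopt] using hb
    exact absurd (hfail.trans_le (hle f hf)) (hf.card_colorClassBelow_le _ _).not_gt
  have hpass : R + σ.arr .res 0 v ≤ c := by simpa [hrv, hc, htotal, hopt] using hb
  refine (wp_colorSolution h hN hc hrv hcount hC hopt hcur rfl).mono ?_
  rintro σ' hf' ⟨S, hS, hsum, hcolor, hcur', hres⟩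
  replace hres : σ'.arr .res 0 =
      Function.update (σ.arr .res 0) v (σ.arr .res 0 v + R) := hres.trans (by rw [htotal])
  refine ⟨fun f hf => ⟨(hf'.reg .ok rfl).trans hok, fun x hx => ?_⟩, fun _ => ⟨_, ?_, hcur', ?_⟩⟩
  · rw [hres, Function.update_apply]
    split_ifs with hxv
    · rw [hxv, add_comm]
      exact hle f hf
    · exact (hI.complete f hf).2 x hx
  · have hR : ∑ w ∈ t.children v \ S, σ.arr .res 0 w = R :=
      (Nat.eq_sub_of_add_eq (sum_sdiff hS)).trans (by rw [hsum])
    rw [hres, ← hR]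
    exact hcol.treat hv hvP hch hS (hsum ▸ knapsack_le _ _ _) (Nat.succ_ne_zero _)
      (fun x hx => ((hlt x hx).trans_lt (Nat.lt_succ_self _)).ne) (by rwa [hR, add_comm])
  · intro x hx
    rw [hcolor]
    unfold recolor paint
    split_ifs
    exacts [le_rfl, (hlt x hx).trans (Nat.le_succ _)]

theorem wp_processVertex (h : t.IsLabelledInput σ) (hN : n ≤ N) (hc : σ.reg .c = c)
    (hcN : c + 1 ≤ N) (hok : σ.reg .ok = 1) (hv : v < n) (hrv : σ.reg .v = v)
    (hd : σ.reg .d = t.depth v + 1) (hvP : v ∉ P) (hch : ∀ w ∈ t.children v, w ∈ P)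
    (hI : t.TestInv c P σ) : Wp N processVertex (t.TestInv c (insert v P)) σ := by
  refine wp_block_cons ((wp_listChildren h hN hv hrv hd).mono ?_)
  rintro σ₁ hf₁ ⟨hC, htotal⟩
  have hres₁ : σ₁.arr .res = σ.arr .res := hf₁.arr .res rfl
  have hok₁ : σ₁.reg .ok = 1 := (hf₁.reg .ok rfl).trans hok
  have hc₁ : σ₁.reg .c = c := (hf₁.reg .c rfl).trans hc
  have hI₁ : t.TestInv c P σ₁ :=
    hI.congr (hf₁.reg .ok rfl) (hf₁.reg .color rfl) hres₁ (hf₁.arr .cur rfl)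
  have hcount : σ₁.reg .count ≤ N := by
    rw [hC.card]
    exact (card_filter_le _ _).trans ((card_range n).trans_le hN)
  refine wp_block_singleton (wp_when (fun _ => ?_) fun hb => ?_)
  · refine wp_block_cons ((wp_solveKnapsack hc₁ hcN hcount).mono fun σ₂ hf₂ hopt =>
      wp_block_singleton ?_)
    have hres₂ : σ₂.arr .res = σ₁.arr .res := hf₂.arr .res rfl
    have hchild₂ : σ₂.arr .child = σ₁.arr .child := hf₂.arr .child rfl
    have hcount₂ : σ₂.reg .count = σ₁.reg .count := hf₂.reg .count rfl
    have hitem : itemSize σ₂ = itemSize σ₁ := by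
      unfold itemSize
      rw [hres₂, hchild₂]
    refine wp_testResidual ((h.frame hf₁).frame hf₂) hN ((hf₂.reg .c rfl).trans hc₁)
      ((hf₂.reg .ok rfl).trans hok₁) hv ((hf₂.reg .v rfl).trans ((hf₁.reg .v rfl).trans hrv))
      hvP hch (hI₁.congr (hf₂.reg .ok rfl) (hf₂.reg .color rfl) hres₂ (hf₂.arr .cur rfl))
      (hcount₂ ▸ hcount) ?_ ?_ (by rwa [hitem, hcount₂])
    · unfold Lists at hC ⊢
      rwa [hchild₂, hcount₂]
    · rw [hres₂, hres₁, hf₂.reg .total rfl, htotal]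
  · have hleaf : t.children v = ∅ := by simpa [hC.card] using hb
    exact hI₁.insert_leaf hok₁ hv hvP hleaf

end RootedTree

/-! ### The rounds of a test -/

namespace RootedTree

variable {n N c d v : ℕ} {t : RootedTree n} {P : Set ℕ} {m m' : ℕ → ℕ → ℕ} {σ : Memory Reg Arr}

/-- The vertices that have been treated when the round for label `d` has reached `v`; the label of a
vertex is its depth plus one, and the rounds are in descending order of labels. -/
def processed (t : RootedTree n) (d v : ℕ) : Set ℕ :=
  {x | x < n ∧ (d < t.depth x + 1 ∨ t.depth x + 1 = d ∧ x < v)}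

theorem mem_processed {x : ℕ} :
    x ∈ t.processed d v ↔ x < n ∧ (d < t.depth x + 1 ∨ t.depth x + 1 = d ∧ x < v) :=
  Iff.rfl

theorem insert_processed (hv : v < n) (hd : t.depth v + 1 = d) :
    insert v (t.processed d v) = t.processed d (v + 1) := by
  ext x
  rw [Set.mem_insert_iff, mem_processed, mem_processed]
  grind

theorem processed_succ_of_ne (hd : t.depth v + 1 ≠ d) :
    t.processed d (v + 1) = t.processed d v := by
  ext x
  rw [mem_processed, mem_processed]
  grind

theorem processed_succ_left : t.processed (d + 1) n = t.processed d 0 := by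
  ext x
  rw [mem_processed, mem_processed]
  omega

theorem notMem_processed_top {x : ℕ} (hx : x < n) : x ∉ t.processed n 0 := by
  rw [mem_processed]
  have := t.depth_lt hx
  omega

theorem TestInv.start (hc : 1 ≤ c) (hP : ∀ x < n, x ∉ P) (hok : σ.reg .ok = 1)
    (hres : ∀ x < n, σ.arr .res 0 x = if x = t.root then 0 else 1)
    (hcur : ∀ x < n, ∀ y < n, σ.arr .cur x y = 0) : t.TestInv c P σ where
  complete f _ := by
    refine ⟨hok, fun x hx => ?_⟩
    rw [hres x hx]
    split_ifs with hr
    · exact Nat.zero_le _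
    · exact card_pos.2 ⟨x, mem_colorClassBelow.2 ⟨mem_colorClass.2 ⟨hx, hr, rfl⟩, .base hx rfl⟩⟩
  sound _ := by
    refine ⟨_, .start hc hP hres, fun z hz hr x y hxy => ?_, fun _ _ => Nat.zero_le _⟩
    exact hcur x (hxy.lt hz hr).1 y (hxy.lt hz hr).2

theorem wp_testLevel (h : t.IsLabelledInput σ) (hN : n ≤ N) (hc : σ.reg .c = c)
    (hcN : c + 1 ≤ N) (hd : σ.reg .d = d) (hI : t.TestInv c (t.processed d 0) σ) :
    Wp N (forTo .v (.reg .n) [when (.and (.eq (.vec .label (.reg .v)) (.reg .d))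
      (.eq (.reg .ok) 1)) [processVertex]]) (t.TestInv c (t.processed d n)) σ := by
  refine wp_forTo (fun v => t.TestInv c (t.processed d v)) hN rfl
    (fun σ' hf => (hf.reg .n rfl).trans h.reg_n) (fun _ _ _ h => h.congr) hI ?_ fun _ _ h => h
  intro v hv σ' hf hrv hI'
  have h' : t.IsLabelledInput σ' := h.frame hf
  have hc' : σ'.reg .c = c := (hf.reg .c rfl).trans hc
  have hd' : σ'.reg .d = d := (hf.reg .d rfl).trans hd
  refine wp_block_singleton (wp_when (fun hb => wp_block_singleton ?_) fun hb => ?_)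
  · obtain ⟨hdv, hok⟩ : t.depth v + 1 = d ∧ σ'.reg .ok = 1 := by
      rw [Test.eval, Bool.and_eq_true] at hb
      exact ⟨by simpa [hrv, h'.label_eq v hv, hd'] using hb.1, of_decide_eq_true hb.2⟩
    rw [← insert_processed hv hdv]
    refine wp_processVertex h' hN hc' hcN hok hv hrv (hd'.trans hdv.symm) ?_ (fun w hw => ?_) hI'
    · rw [mem_processed]
      omega
    · have hdw := depth_of_mem_children hw
      exact mem_processed.2 ⟨lt_of_mem_children hw, .inl (by omega)⟩
  · by_cases hok : σ'.reg .ok = 1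
    · have hdv : t.depth v + 1 ≠ d := by simpa [hrv, h'.label_eq v hv, hd', hok] using hb
      rwa [processed_succ_of_ne hdv]
    · exact hI'.of_failed hok

theorem wp_testVertices (h : t.IsLabelledInput σ) (hN : n ≤ N) (hc : σ.reg .c = c)
    (hcN : c + 1 ≤ N) (hI : t.TestInv c (t.processed n 0) σ) :
    Wp N (forTo .k (.reg .n) [.set .d (.sub (.reg .n) (.reg .k)),
      forTo .v (.reg .n) [when (.and (.eq (.vec .label (.reg .v)) (.reg .d))
        (.eq (.reg .ok) 1)) [processVertex]]]) (t.TestInv c (t.processed 0 0)) σ := by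
  refine wp_forTo (fun k => t.TestInv c (t.processed (n - k) 0)) hN rfl
    (fun σ' hf => (hf.reg .n rfl).trans h.reg_n) (fun _ _ _ h => h.congr) hI ?_
    fun σ' _ h => by simpa using h
  intro k hk σ' hf hrk hI'
  have h' : t.IsLabelledInput σ' := h.frame hf
  have hd : σ'.reg .n - σ'.reg .k = n - k := by rw [h'.reg_n, hrk]
  obtain ⟨e, he⟩ : ∃ e, n - k = e + 1 := ⟨n - k - 1, by omega⟩
  have he' : n - (k + 1) = e := by omega
  rw [he', ← processed_succ_left, ← he]
  refine wp_block_cons (wp_set (wp_block_singleton ?_))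
  exact wp_testLevel (σ := σ'.setReg .d (σ'.reg .n - σ'.reg .k)) h'.congr hN
    ((hf.reg .c rfl).trans hc) hcN hd hI'.congr

/-- The matrix `m` stores a solution for the candidate `c` that colors all edges, `0` standing for
uncolored. -/
def Solution (t : RootedTree n) (c : ℕ) (m : ℕ → ℕ → ℕ) : Prop :=
  ∃ f, t.IsSolution c f ∧ t.Represents m f ∧ ∀ x < n, f x ≠ 0

theorem Solution.congr (h : t.Solution c m) (hm : ∀ x < n, ∀ y < n, m' x y = m x y) :
    t.Solution c m' :=
  h.imp fun _ ⟨hf, hrep, h0⟩ => ⟨hf, hrep.congr_matrix hm, h0⟩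

theorem TestInv.exists_isSolution (h : t.TestInv c P σ) (hP : ∀ x < n, x ∈ P)
    (hok : σ.reg .ok = 1) : ∃ col, t.Represents (σ.arr .cur) col ∧
      t.IsSolution c fun x => if col x = 0 then σ.reg .color + 1 else col x := by
  obtain ⟨col, hcol, hcur, hlt⟩ := h.sound hok
  exact ⟨col, hcur, hcol.isSolution hP fun x hx => ((hlt x hx).trans_lt (Nat.lt_succ_self _)).ne⟩

theorem wp_storeSolution (h : t.IsInput σ) (hN : n ≤ N) (hc : σ.reg .c = c)
    (hI : t.TestInv c P σ) (hP : ∀ x < n, x ∈ P) (hok : σ.reg .ok = 1) :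
    Wp N (block [colorRemaining, copyColoring .cur .U, .set .u (.reg .c), .set .stored 1])
      (fun σ' => σ'.reg .u = c ∧ σ'.reg .stored = 1 ∧ t.Solution c (σ'.arr .U)) σ := by
  obtain ⟨col, hcur, hf⟩ := hI.exists_isSolution hP hok
  refine wp_block_cons ((wp_colorRemaining h hN hcur rfl).mono fun σ₁ hf₁ hcur₁ => ?_)
  refine wp_block_cons ((wp_copyColoring (by decide) hN (h.frame hf₁).reg_n).mono
    fun σ₂ hf₂ hU => wp_block_cons (wp_set (wp_block_singleton (wp_set ⟨?_, rfl, ?_⟩))))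
  · exact (hf₂.reg .c rfl).trans ((hf₁.reg .c rfl).trans hc)
  · refine Solution.congr ⟨_, hf, hcur₁, fun x _ => ?_⟩ hU
    split_ifs with hx
    exacts [Nat.succ_ne_zero _, hx]

theorem wp_concludeTest (h : t.IsInput σ) (hN : n ≤ N) (hc : σ.reg .c = c)
    (hI : t.TestInv c P σ) (hP : ∀ x < n, x ∈ P) :
    Wp N (.ite (.eq (.reg .ok) 1)
      (block [colorRemaining, copyColoring .cur .U, .set .u (.reg .c), .set .stored 1])
      (.set .l (.add (.reg .c) 1)))
      (fun σ' =>
        (σ'.reg .l = σ.reg .l ∧ σ'.reg .u = c ∧ σ'.reg .stored = 1 ∧ t.Solution c (σ'.arr .U)) ∨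
        ((∀ f, ¬ t.IsSolution c f) ∧ σ'.reg .l = c + 1 ∧ σ'.reg .u = σ.reg .u ∧
          σ'.reg .stored = σ.reg .stored ∧ σ'.arr .U = σ.arr .U)) σ := by
  refine wp_ite (fun hb => ?_) fun hb => wp_set (.inr ⟨fun f hf => ?_, ?_, rfl, rfl, rfl⟩)
  · refine (wp_storeSolution h hN hc hI hP (of_decide_eq_true hb)).mono fun σ' hf hpost => ?_
    exact .inl ⟨hf.reg .l rfl, hpost⟩
  · exact of_decide_eq_false hb (hI.complete f hf).1
  · simp [hc]

theorem wp_testCandidate (h : t.IsLabelledInput σ) (hN : n ≤ N)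
    (hc : (σ.reg .l + σ.reg .u) / 2 = c) (hc₁ : 1 ≤ c) (hcN : c + 1 ≤ N) :
    Wp N testCandidate (fun σ' =>
      (σ'.reg .l = σ.reg .l ∧ σ'.reg .u = c ∧ σ'.reg .stored = 1 ∧ t.Solution c (σ'.arr .U)) ∨
      ((∀ f, ¬ t.IsSolution c f) ∧ σ'.reg .l = c + 1 ∧ σ'.reg .u = σ.reg .u ∧
        σ'.reg .stored = σ.reg .stored ∧ σ'.arr .U = σ.arr .U)) σ := by
  refine wp_block_cons ((wp_fill .res 1 hN h.reg_n).mono fun σ₁ hf₁ hres₁ =>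
    wp_block_cons (wp_putVec (wp_block_cons (wp_set (wp_block_cons ?_)))))
  have h₁ : t.IsLabelledInput σ₁ := h.frame hf₁
  refine Wp.mono (wp_fillMatrix .cur 0 hN h₁.reg_n) fun σ₂ hf₂ hcur₂ =>
    wp_block_cons (wp_set (wp_block_cons (wp_set (wp_block_cons ?_))))
  have hc₂ : σ₂.reg .c = c := by simpa [hf₂.reg .c rfl, hf₁.reg .l rfl, hf₁.reg .u rfl] using hc
  have hres₂ : ∀ x < n, σ₂.arr .res 0 x = if x = t.root then 0 else 1 := fun x hx => by
    simp [hf₂.arr .res rfl, h₁.reg_root, Function.update_apply, hres₁ x hx]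
  have h₂ : t.IsLabelledInput ((σ₂.setReg .color 0).setReg .ok 1) :=
    ⟨⟨(hf₂.reg .n rfl).trans h₁.reg_n, (hf₂.reg .root rfl).trans h₁.reg_root,
      (hf₂.arr .adj rfl).symm ▸ h₁.isAdjMatrix⟩, (hf₂.arr .label rfl).symm ▸ h₁.label_eq⟩
  have hI : t.TestInv c (t.processed n 0) ((σ₂.setReg .color 0).setReg .ok 1) :=
    .start hc₁ (fun _ => notMem_processed_top) rfl hres₂ hcur₂
  refine (wp_testVertices h₂ hN hc₂ hcN hI).mono fun σ₃ hf₃ hI₃ => wp_block_singleton ?_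
  refine (wp_concludeTest (h₂.frame hf₃).toIsInput hN ((hf₃.reg .c rfl).trans hc₂) hI₃ ?_).mono ?_
  · exact fun x hx => mem_processed.2 ⟨hx, .inl (Nat.succ_pos _)⟩
  · intro σ' _ hpost
    simpa [hf₃.reg .l rfl, hf₃.reg .u rfl, hf₃.reg .stored rfl, hf₃.arr .U rfl, hf₂.reg .l rfl,
      hf₂.reg .u rfl, hf₂.reg .stored rfl, hf₂.arr .U rfl, hf₁.reg .l rfl, hf₁.reg .u rfl,
      hf₁.reg .stored rfl, hf₁.arr .U rfl] using hpost

end RootedTree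

/-! ### Degrees -/

namespace RootedTree

variable {n N c v w₀ : ℕ} {t : RootedTree n} {f : ℕ → ℕ} {a : ℕ → ℕ → ℕ} {σ : Memory Reg Arr}

theorem IsAdjMatrix.degree_root (h : t.IsAdjMatrix a) :
    degree n a t.root = #(t.children t.root) := by
  refine congrArg card (Finset.ext fun w => ?_)
  rw [mem_filter, mem_range, mem_children]
  refine and_congr_right fun hw => ?_
  simp [h t.root t.root_lt w hw]

theorem IsAdjMatrix.degree_of_ne_root (h : t.IsAdjMatrix a) (hv : v < n) (hr : v ≠ t.root) :
    degree n a v = #(t.children v) + 1 := by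
  have hpar : t.parent v ∉ t.children v := fun hmem => by
    have h₁ := depth_of_mem_children hmem
    have h₂ := t.depth_eq v hv hr
    omega
  rw [← card_insert_of_notMem hpar]
  refine congrArg card (Finset.ext fun w => ?_)
  rw [mem_filter, mem_range, mem_insert, mem_children]
  have hlt := t.parent_lt v hv hr
  have hadj := h v hv w
  grind

theorem IsSolution.card_children_root_le (hf : t.IsSolution c f) :
    #(t.children t.root) ≤ 2 * c := by
  obtain ⟨K, hK⟩ := hf.exists_color t.root t.root_lt
  have hsub : t.children t.root ⊆ t.colorClass f K ∪ t.colorClass f (f t.root) := fun w hw => by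
    obtain ⟨hwn, hwr, -⟩ := mem_children.1 hw
    rw [mem_union, mem_colorClass, mem_colorClass]
    exact (hK w hw).imp (fun h => ⟨hwn, hwr, h⟩) fun h => ⟨hwn, hwr, h⟩
  calc #(t.children t.root) ≤ #(t.colorClass f K) + #(t.colorClass f (f t.root)) :=
        (card_le_card hsub).trans (card_union_le _ _)
    _ ≤ 2 * c := by
        rw [two_mul]
        exact add_le_add (hf.card_colorClass_le _) (hf.card_colorClass_le _)

/-- The coloring that gives the edges from each vertex to its children a color of their own, except
that the edge above `w₀`, a child of the root, has the extra color `n`. -/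
def starColoring (t : RootedTree n) (w₀ : ℕ) : ℕ → ℕ :=
  fun x => if x = w₀ ∨ x = t.root then n else t.parent x

theorem colorClass_starColoring_subset {k : ℕ} :
    t.colorClass (t.starColoring w₀) k ⊆ if k = n then {w₀} else (t.children k).erase w₀ := by
  intro x hx
  obtain ⟨hxn, hxr, hx⟩ := mem_colorClass.1 hx
  have hpar := t.parent_lt x hxn hxr
  unfold starColoring at hx
  split_ifs with hk
  · rw [mem_singleton]
    grind
  · rw [mem_erase, mem_children]
    grind

theorem exists_isSolution (hc : 1 ≤ c) (hroot : #(t.children t.root) ≤ c + 1)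
    (hchildren : ∀ v < n, v ≠ t.root → #(t.children v) ≤ c) : ∃ f, t.IsSolution c f := by
  obtain ⟨w₀, hw₀, hcard⟩ : ∃ w₀, (w₀ = t.root ∨ w₀ ∈ t.children t.root) ∧
      #((t.children t.root).erase w₀) ≤ c := by
    rcases (t.children t.root).eq_empty_or_nonempty with h | ⟨w, hw⟩
    · exact ⟨t.root, .inl rfl, by simp [h]⟩
    · refine ⟨w, .inr hw, ?_⟩
      rw [card_erase_of_mem hw]
      omega
  refine ⟨t.starColoring w₀, fun v _ => ⟨v, fun w hw => ?_⟩, fun k => ?_⟩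
  · obtain ⟨-, hwr, hwv⟩ := mem_children.1 hw
    rw [mem_children] at hw₀
    unfold starColoring
    grind
  · refine (card_le_card colorClass_starColoring_subset).trans ?_
    split_ifs
    · rwa [card_singleton]
    · rcases eq_or_ne k t.root with rfl | hkr
      · exact hcard
      · refine card_erase_le.trans ?_
        rcases (t.children k).eq_empty_or_nonempty with h | ⟨x, hx⟩
        · simp [h]
        · obtain ⟨hxn, hxr, rfl⟩ := mem_children.1 hx
          exact hchildren _ (t.parent_lt x hxn hxr) hkr

theorem isSolution_one (hroot : #(t.children t.root) ≤ c)
    (hchildren : ∀ v < n, v ≠ t.root → t.children v = ∅) : t.IsSolution c fun _ => 1 where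
  exists_color v _ := ⟨1, fun _ _ => .inl rfl⟩
  card_colorClass_le k := by
    refine (card_le_card fun x hx => ?_).trans hroot
    obtain ⟨hxn, hxr, -⟩ := mem_colorClass.1 hx
    refine mem_children.2 ⟨hxn, hxr, by_contra fun hpr => ?_⟩
    have hx : x ∈ t.children (t.parent x) := mem_children.2 ⟨hxn, hxr, rfl⟩
    simp [hchildren _ (t.parent_lt x hxn hxr) hpr] at hx

/-! ### The search for the optimum -/

/-- There is a `2`-coloring of `t` all of whose color groups have size at most `c`. -/
def Feasible (t : RootedTree n) (c : ℕ) : Prop := ∃ f, t.IsSolution c f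

/-- The invariant of the search for the least feasible `c` between `l` and `u`. -/
structure SearchInv (t : RootedTree n) (σ : Memory Reg Arr) : Prop where
  one_le : 1 ≤ σ.reg .l
  lower : σ.reg .l ∈ lowerBounds {c | t.Feasible c}
  feasible : t.Feasible (σ.reg .u)
  stored : σ.reg .stored = 0 ∨ σ.reg .stored = 1 ∧ t.Solution (σ.reg .u) (σ.arr .U)

/-- The number of candidates that the search may still have to test at most; the second summand
counts a missing coloring. -/
def searchMeasure (σ : Memory Reg Arr) : ℕ :=
  σ.reg .u - σ.reg .l + (1 - σ.reg .stored)

theorem wp_searchStep (h : t.IsLabelledInput σ) (hN : n ≤ N) (hI : t.SearchInv σ)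
    (hu : σ.reg .u + 1 ≤ N)
    (hne : ¬ (σ.reg .l = σ.reg .u ∧ σ.reg .stored = 1)) :
    Wp N testCandidate (fun σ' => t.SearchInv σ' ∧ σ'.reg .u ≤ σ.reg .u ∧
      searchMeasure σ' < searchMeasure σ) σ := by
  obtain ⟨hl, hlower, hfeas, hstored⟩ := hI
  have hlu : σ.reg .l ≤ σ.reg .u := hlower hfeas
  have hstored₁ : σ.reg .stored ≤ 1 := hstored.elim (·.le.trans zero_le_one) (·.1.le)
  unfold searchMeasure
  refine (wp_testCandidate h hN rfl (by omega) (by omega)).mono ?_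
  rintro σ' - (⟨hl', hu', hs', hsol⟩ | ⟨hnot, hl', hu', hs', hU'⟩)
  · refine ⟨⟨by omega, hl' ▸ hlower, ?_, .inr ⟨hs', hu' ▸ hsol⟩⟩, by omega, by omega⟩
    obtain ⟨f, hf, -⟩ := hsol
    exact hu' ▸ ⟨f, hf⟩
  · have hlower' : σ'.reg .l ∈ lowerBounds {c | t.Feasible c} := fun c ⟨f, hf⟩ => by
      by_contra hlt
      exact hnot f (hf.mono (by omega))
    have hlu' : σ'.reg .l ≤ σ.reg .u := hlower' hfeas
    exact ⟨⟨by omega, hlower', hu' ▸ hfeas, by rwa [hs', hu', hU']⟩, by omega,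
      by omega⟩

theorem wp_search (h : t.IsLabelledInput σ) (hN : n ≤ N) (hI : t.SearchInv σ)
    (hu : σ.reg .u + 1 ≤ N) :
    Wp N (.loop (.not (.and (.eq (.reg .l) (.reg .u)) (.eq (.reg .stored) 1))) testCandidate)
      (fun σ' => IsLeast {c | t.Feasible c} (σ'.reg .u) ∧ t.Solution (σ'.reg .u) (σ'.arr .U))
      σ := by
  have heval : ∀ σ : Memory Reg Arr, Test.eval σ (.not (.and (.eq (.reg .l) (.reg .u))
      (.eq (.reg .stored) 1))) = !decide (σ.reg .l = σ.reg .u ∧ σ.reg .stored = 1) := fun σ =>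
    congrArg _ (Bool.decide_and _ _).symm
  have hμ : searchMeasure σ ≤ N := by
    have := hI.one_le
    unfold searchMeasure
    omega
  refine (wp_loop (fun σ' => t.SearchInv σ' ∧ σ'.reg .u ≤ σ.reg .u) searchMeasure hμ
    ⟨hI, le_rfl⟩ ?_).mono ?_
  · rintro σ₁ hf ⟨hI₁, hu₁⟩ hb
    have hne : ¬ (σ₁.reg .l = σ₁.reg .u ∧ σ₁.reg .stored = 1) := by
      rw [heval, Bool.not_eq_true'] at hb
      exact of_decide_eq_false hb
    refine (wp_searchStep (h.frame hf) hN hI₁ (by omega) hne).mono ?_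
    exact fun σ₂ _ ⟨hI₂, hu₂, hlt⟩ => ⟨⟨hI₂, hu₂.trans hu₁⟩, hlt⟩
  · rintro σ₁ - ⟨⟨hI₁, -⟩, hb⟩
    obtain ⟨hlu, hs⟩ : σ₁.reg .l = σ₁.reg .u ∧ σ₁.reg .stored = 1 := by
      rw [heval, Bool.not_eq_false'] at hb
      exact of_decide_eq_true hb
    have hsol := hI₁.stored.resolve_left (by simp [hs])
    exact ⟨⟨hI₁.feasible, hlu ▸ hI₁.lower⟩, hsol.2⟩

end RootedTree

/-! ### The whole algorithm -/

section WholeAlgorithm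

variable {n N : ℕ} {a : ℕ → ℕ → ℕ} {F : ℕ → Prop} {σ : Memory Reg Arr}

namespace RootedTree

variable {t : RootedTree n}

theorem wp_searchRoot (h : t.IsInput σ) (hN : n ≤ N) (hΔ : 2 ≤ σ.reg .Delta)
    (hΔN : σ.reg .Delta ≤ N) (hlower : (σ.reg .Delta + 1) / 2 ∈ lowerBounds {c | t.Feasible c})
    (hupper : t.Feasible (σ.reg .Delta - 1)) (hm : t.Feasible (σ.reg .m)) :
    Wp N (block [labelVertices, .set .l (.half (.add (.reg .Delta) 1)),
      .set .u (.sub (.reg .Delta) 1), .set .stored 0,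
      .loop (.not (.and (.eq (.reg .l) (.reg .u)) (.eq (.reg .stored) 1))) testCandidate,
      when (.le (.reg .u) (.reg .m)) [.set .m (.reg .u), copyColoring .U .M]])
      (fun σ' => IsLeast {c | t.Feasible c} (σ'.reg .m) ∧ t.Solution (σ'.reg .m) (σ'.arr .M))
      σ := by
  refine wp_block_cons ((wp_labelVertices h hN).mono fun σ₁ hf₁ h₁ => wp_block_cons (wp_set
    (wp_block_cons (wp_set (wp_block_cons (wp_set (wp_block_cons ?_)))))))
  have hΔ₁ : σ₁.reg .Delta = σ.reg .Delta := hf₁.reg .Delta rfl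
  rw [← hΔ₁] at hΔ hΔN hlower hupper
  have hI : t.SearchInv (((σ₁.setReg .l ((σ₁.reg .Delta + 1) / 2)).setReg .u
      (σ₁.reg .Delta - 1)).setReg .stored 0) :=
    ⟨show 1 ≤ (σ₁.reg .Delta + 1) / 2 by omega, hlower, hupper, .inl rfl⟩
  have hu : σ₁.reg .Delta - 1 + 1 ≤ N := by omega
  refine Wp.mono (wp_search h₁.congr hN hI hu) ?_
  rintro σ₂ hf₂ ⟨hleast, hsol⟩
  have hm₂ : σ₂.reg .m = σ.reg .m := (hf₂.reg .m rfl).trans (hf₁.reg .m rfl)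
  have hn₂ : σ₂.reg .n = n := (hf₂.reg .n rfl).trans h₁.reg_n
  refine wp_block_singleton (wp_when (fun _ => wp_block_cons (wp_set ?_)) fun hb => ?_)
  · refine wp_block_singleton (Wp.mono (wp_copyColoring (by decide) hN hn₂) fun σ₃ hf₃ hM => ?_)
    rw [hf₃.reg .m rfl]
    exact ⟨hleast, hsol.congr hM⟩
  · have hle : σ₂.reg .u ≤ σ₂.reg .m := hleast.2 (hm₂ ▸ hm)
    simp [hle] at hb

end RootedTree

/-- The memory holds the optimum and an optimal coloring of a tree with adjacency matrix `a`, where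
`F c` says that there is a coloring whose color groups have size at most `c`. -/
structure Outcome (n : ℕ) (a : ℕ → ℕ → ℕ) (F : ℕ → Prop) (σ : Memory Reg Arr) : Prop where
  isLeast : IsLeast {c | F c} (σ.reg .m)
  solution : ∃ t : RootedTree n, t.IsAdjMatrix a ∧ t.Solution (σ.reg .m) (σ.arr .M)

/-- The matrix `a` is the adjacency matrix of a tree, which may be rooted at any vertex, and `F c`
says that there is a coloring whose color groups have size at most `c`. -/
def IsRootable (n : ℕ) (a : ℕ → ℕ → ℕ) (F : ℕ → Prop) : Prop :=
  ∀ r < n, ∃ t : RootedTree n, t.root = r ∧ t.IsAdjMatrix a ∧ t.Feasible = F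

theorem IsRootable.maxDeg_le_two_mul {c : ℕ} (h : IsRootable n a F) (hc : F c) :
    maxDeg n a ≤ 2 * c := by
  refine Finset.sup_le fun x hx => ?_
  obtain ⟨t, rfl, ha, rfl⟩ := h x (mem_range.1 hx)
  obtain ⟨f, hf⟩ := hc
  exact ha.degree_root ▸ hf.card_children_root_le

theorem IsRootable.maxDeg_sub_one (h : IsRootable n a F) (h0 : 0 < n) (h2 : 2 ≤ maxDeg n a) :
    F (maxDeg n a - 1) := by
  obtain ⟨t, -, ha, rfl⟩ := h 0 h0
  refine RootedTree.exists_isSolution (by omega) ?_ fun v hv hr => ?_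
  · have := degree_le_maxDeg (a := a) t.root_lt
    rw [ha.degree_root] at this
    omega
  · have := degree_le_maxDeg (a := a) hv
    rw [ha.degree_of_ne_root hv hr] at this
    omega

theorem wp_smallTree (h : IsRootable n (σ.arr .adj) F) (h0 : 0 < n) (hN : n ≤ N)
    (hn : σ.reg .n = n) (hΔ : σ.reg .Delta = maxDeg n (σ.arr .adj)) (h1 : σ.reg .Delta ≤ 1) :
    Wp N (block [.set .m (.reg .Delta),
      forTo .x (.reg .n) [forTo .y (.reg .n) [.put .M (.reg .x) (.reg .y) 1]]])
      (Outcome n (σ.arr .adj) F) σ := by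
  refine wp_block_cons (wp_set (wp_block_singleton
    (Wp.mono (wp_fillMatrix .M 1 hN hn) fun σ' hf hM => ?_)))
  obtain ⟨t, -, ha, rfl⟩ := id h 0 h0
  have hm : σ'.reg .m = maxDeg n (σ.arr .adj) := (hf.reg .m rfl).trans hΔ
  rw [hΔ] at h1
  have hsol : t.IsSolution (σ'.reg .m) fun _ => 1 := by
    rw [hm]
    refine RootedTree.isSolution_one (ha.degree_root ▸ degree_le_maxDeg t.root_lt) fun v hv hr => ?_
    have := ha.degree_of_ne_root hv hr ▸ degree_le_maxDeg (a := σ.arr .adj) hv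
    rw [← card_eq_zero]
    omega
  refine ⟨⟨⟨_, hsol⟩, fun c hc => ?_⟩, t, ha, _, hsol, ?_, fun _ _ => one_ne_zero⟩
  · have := h.maxDeg_le_two_mul hc
    omega
  · exact fun z hz hr x y hxy => hM x (hxy.lt hz hr).1 y (hxy.lt hz hr).2

theorem wp_treeColoring (h : IsRootable n (σ.arr .adj) F) (h0 : 0 < n) (hN : n ≤ N)
    (hn : σ.reg .n = n) : Wp N treeColoring (Outcome n (σ.arr .adj) F) σ := by
  refine wp_block_cons ((wp_maxDegree hN hn).mono fun σ₁ hf₁ hΔ => wp_block_singleton ?_)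
  have ha₁ : σ₁.arr .adj = σ.arr .adj := hf₁.arr .adj rfl
  have hn₁ : σ₁.reg .n = n := (hf₁.reg .n rfl).trans hn
  rw [← ha₁] at h hΔ ⊢
  refine wp_ite (fun hb => wp_smallTree h h0 hN hn₁ hΔ (of_decide_eq_true hb)) fun hb => ?_
  have h2 : 2 ≤ σ₁.reg .Delta := not_le.1 (of_decide_eq_false hb)
  have hΔN : σ₁.reg .Delta ≤ N := hΔ.trans_le (maxDeg_le.trans hN)
  have hlower : ∀ c, F c → (σ₁.reg .Delta + 1) / 2 ≤ c := fun c hc => by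
    have := hΔ.trans_le (h.maxDeg_le_two_mul hc)
    omega
  have hupper : F (σ₁.reg .Delta - 1) := hΔ ▸ h.maxDeg_sub_one h0 (hΔ ▸ h2)
  refine wp_block_cons (wp_set (wp_block_singleton ?_))
  refine wp_forTo (fun k σ' => F (σ'.reg .m) ∧ (0 < k → Outcome n (σ₁.arr .adj) F σ')) hN rfl
    (fun σ' hf => (hf.reg .n rfl).trans hn₁) (fun _ _ _ ⟨hF, hout⟩ => ⟨hF, fun hk => ?_⟩)
    ⟨hupper, fun h => absurd h (lt_irrefl 0)⟩ ?_ fun _ _ h => h.2 h0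
  · exact ⟨(hout hk).1, (hout hk).2⟩
  · rintro r hr σ₂ hf₂ hroot ⟨hF, -⟩
    obtain ⟨t, ht, ha, hFt⟩ := h r hr
    have hadj : σ₂.arr .adj = σ₁.arr .adj := hf₂.arr .adj rfl
    have hΔ₂ : σ₂.reg .Delta = σ₁.reg .Delta := hf₂.reg .Delta rfl
    have hin : t.IsInput σ₂ := ⟨(hf₂.reg .n rfl).trans hn₁, hroot.trans ht.symm, hadj ▸ ha⟩
    subst hFt
    refine (RootedTree.wp_searchRoot hin hN (hΔ₂ ▸ h2) (hΔ₂ ▸ hΔN) (hΔ₂ ▸ hlower) (hΔ₂ ▸ hupper)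
      hF).mono ?_
    exact fun σ₃ _ ⟨hleast, hsol⟩ => ⟨hleast.1, fun _ => ⟨hleast, t, ha, hsol⟩⟩

end WholeAlgorithm

/-! ## Trees as graphs -/

section Parent

variable {V : Type*} {G : SimpleGraph V} {r x : V}

theorem exists_adj_dist_eq_add_one (hG : G.Connected) (hx : x ≠ r) :
    ∃ y, G.Adj x y ∧ G.dist r x = G.dist r y + 1 := by
  obtain ⟨p, hp⟩ := hG.exists_walk_length_eq_dist x r
  cases p with
  | nil => exact absurd rfl hx
  | @cons _ y _ h q =>
    refine ⟨y, h, ?_⟩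
    have hq := SimpleGraph.dist_le q
    have hdiff := h.diff_dist_adj (u := r)
    rw [SimpleGraph.Walk.length_cons, SimpleGraph.dist_comm] at hp
    rw [SimpleGraph.dist_comm] at hq
    omega

theorem exists_isPath_penultimate_eq (hG : G.Connected) {y : V} (h : G.Adj x y)
    (hd : G.dist r x = G.dist r y + 1) : ∃ p : G.Walk r x, p.IsPath ∧ p.penultimate = y := by
  obtain ⟨p, hp⟩ := hG.exists_walk_length_eq_dist r y
  exact ⟨p.concat h.symm, SimpleGraph.Walk.isPath_of_length_eq_dist _ (by simp [hp, hd]),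
    p.penultimate_concat h.symm⟩

theorem existsUnique_adj_dist_eq_add_one (hG : G.IsTree) (hx : x ≠ r) :
    ∃! y, G.Adj x y ∧ G.dist r x = G.dist r y + 1 := by
  refine existsUnique_of_exists_of_unique (exists_adj_dist_eq_add_one hG.connected hx) ?_
  rintro y y' ⟨h, hd⟩ ⟨h', hd'⟩
  obtain ⟨p, hp, rfl⟩ := exists_isPath_penultimate_eq hG.connected h hd
  obtain ⟨p', hp', rfl⟩ := exists_isPath_penultimate_eq hG.connected h' hd'
  have := (hG.isAcyclic.subsingleton_path r x).elim ⟨p, hp⟩ ⟨p', hp'⟩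
  rw [Subtype.mk.inj this]

end Parent

theorem exists_subset_pair {α : Type*} {s : Set α} {p : α} (hs : s.encard ≤ 2) (hp : p ∈ s) :
    ∃ q, s ⊆ {q, p} := by
  rw [← Set.encard_sdiff_singleton_add_one hp, ← one_add_one_eq_two,
    ENat.add_le_add_iff_right (by simp)] at hs
  rcases Set.encard_le_one_iff_eq.1 hs with h | ⟨q, h⟩
  · exact ⟨p, fun x hx => by simp_all [Set.sdiff_eq_empty]⟩
  · exact ⟨q, fun x hx => or_iff_not_imp_right.2 fun hxp => h.subset ⟨hx, hxp⟩⟩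

variable {n c k : ℕ} {T : SimpleGraph (Fin n)}

namespace RootedTree

variable {t : RootedTree n} {f : ℕ → ℕ}

/-- The graph `T` is the tree `t`. -/
def IsRootingOf (t : RootedTree n) (T : SimpleGraph (Fin n)) : Prop :=
  ∀ x y : Fin n, T.Adj x y ↔ ∃ z < n, z ≠ t.root ∧ t.Joins z x y

theorem exists_isRootingOf (hT : T.IsTree) (r : Fin n) :
    ∃ t : RootedTree n, t.root = r ∧ t.IsRootingOf T := by
  have : Nonempty (Fin n) := ⟨r⟩
  choose! par hpar hunique using fun x (hx : x ≠ r) => existsUnique_adj_dist_eq_add_one hT hx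
  let t : RootedTree n :=
    { root := r
      parent := fun x => if h : x < n then par ⟨x, h⟩ else 0
      depth := fun x => if h : x < n then T.dist r ⟨x, h⟩ else 0
      root_lt := r.2
      parent_lt := fun x hx _ => by simp [hx]
      depth_root := by simp
      depth_eq := fun x hx hr => by
        simpa [hx] using (hpar ⟨x, hx⟩ fun h => hr (congrArg Fin.val h)).2 }
  have hparent : ∀ x : Fin n, t.parent x = par x := fun x => dif_pos x.2
  have hadj : ∀ x : Fin n, x ≠ r → T.Adj x (par x) := fun x hx => (hpar x hx).1
  have hlower : ∀ x y : Fin n, T.Adj x y → T.dist r x = T.dist r y + 1 →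
      x ≠ r ∧ par x = y := by
    intro x y h hd
    have hx : x ≠ r := by
      rintro rfl
      simp at hd
    exact ⟨hx, (hunique x hx y ⟨h, hd⟩).symm⟩
  refine ⟨t, rfl, fun x y => ⟨fun h => ?_, ?_⟩⟩
  · rcases hT.dist_eq_dist_add_one_of_adj r h with hd | hd
    · obtain ⟨hx, rfl⟩ := hlower x y h hd
      exact ⟨x, x.2, Fin.val_ne_of_ne hx, .inl ⟨rfl, hparent x⟩⟩
    · obtain ⟨hy, rfl⟩ := hlower y x h.symm hd
      exact ⟨y, y.2, Fin.val_ne_of_ne hy, .inr ⟨rfl, hparent y⟩⟩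
  · rintro ⟨z, -, hz, ⟨rfl, h⟩ | ⟨rfl, h⟩⟩
    · rw [← Fin.ext ((hparent x).symm.trans h)]
      exact hadj x fun hx => hz (congrArg Fin.val hx)
    · rw [← Fin.ext ((hparent y).symm.trans h)]
      exact (hadj y fun hy => hz (congrArg Fin.val hy)).symm

theorem isAdjMatrix_input_iff [DecidableRel T.Adj] :
    t.IsAdjMatrix ((input T).arr .adj) ↔ t.IsRootingOf T := by
  have hinput : ∀ x y : Fin n, (input T).arr .adj x y = 1 ↔ T.Adj x y := by simp [input]
  refine ⟨fun h x y => ?_, fun h x hx y hy => ?_⟩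
  · rw [← hinput, h.eq_one_iff x.2 y.2]
  · rw [hinput ⟨x, hx⟩ ⟨y, hy⟩, h]
    unfold Joins
    grind

/-- The edges of `t`. As elsewhere, an edge is represented by its lower end. -/
abbrev Edge (t : RootedTree n) : Type := {z // z < n ∧ z ≠ t.root}

theorem IsRootingOf.existsUnique_joins (h : t.IsRootingOf T) {x y : Fin n} (hxy : T.Adj x y) :
    ∃! z : t.Edge, t.Joins z x y := by
  obtain ⟨z, hz, hr, hj⟩ := (h x y).1 hxy
  exact ⟨⟨z, hz, hr⟩, hj, fun w hw => Subtype.ext (hw.unique w.2.1 w.2.2 hz hr hj)⟩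

/-- The edge of `T` with lower end `z`. -/
def IsRootingOf.edge (h : t.IsRootingOf T) (z : t.Edge) : T.edgeSet :=
  ⟨s(⟨z, z.2.1⟩, ⟨t.parent z, t.parent_lt z z.2.1 z.2.2⟩),
    (h _ _).2 ⟨z, z.2.1, z.2.2, .inl ⟨rfl, rfl⟩⟩⟩

theorem IsRootingOf.edge_eq_iff (h : t.IsRootingOf T) {z : t.Edge} {x y : Fin n}
    (hxy : T.Adj x y) : h.edge z = ⟨s(x, y), hxy⟩ ↔ t.Joins z x y := by
  simp [edge, Joins, Subtype.ext_iff, Fin.ext_iff]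

theorem IsRootingOf.mem_edge (h : t.IsRootingOf T) {z : t.Edge} {v : Fin n} :
    v ∈ (h.edge z).1 ↔ (z : ℕ) = v ∨ t.parent z = v := by
  simp [edge, Fin.ext_iff, eq_comm]

theorem IsRootingOf.bijective_edge (h : t.IsRootingOf T) : Function.Bijective h.edge := by
  refine Function.bijective_iff_existsUnique _ |>.2 ?_
  rintro ⟨e, he⟩
  induction e with
  | _ x y => simpa only [h.edge_eq_iff he] using h.existsUnique_joins he

/-- The edge coloring of `T` that corresponds to the edge coloring `f` of `t`. -/
noncomputable def IsRootingOf.coloring (h : t.IsRootingOf T) (f : ℕ → ℕ) : T.EdgeLabeling ℕ :=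
  fun e => f ((Equiv.ofBijective _ h.bijective_edge).symm e)

theorem IsRootingOf.coloring_edge (h : t.IsRootingOf T) (z : t.Edge) :
    h.coloring f (h.edge z) = f z :=
  congrArg (fun z : t.Edge => f z) (Equiv.ofBijective_symm_apply_apply _ h.bijective_edge z)

theorem IsRootingOf.exists_coloring_eq (h : t.IsRootingOf T) (χ : T.EdgeLabeling ℕ) (p : ℕ) :
    ∃ f, f t.root = p ∧ h.coloring f = χ := by
  refine ⟨fun z => if hz : z < n ∧ z ≠ t.root then χ (h.edge ⟨z, hz⟩) else p, by simp, ?_⟩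
  funext e
  obtain ⟨z, rfl⟩ := h.bijective_edge.surjective e
  rw [h.coloring_edge, dif_pos z.2]

theorem IsRootingOf.encard_coloring (h : t.IsRootingOf T) :
    {e : T.edgeSet | h.coloring f e = k}.encard = #(t.colorClass f k) := by
  have hedge : {e : T.edgeSet | h.coloring f e = k} = h.edge '' {z | f z = k} := by
    ext e
    obtain ⟨z, rfl⟩ := h.bijective_edge.surjective e
    rw [h.bijective_edge.injective.mem_set_image, Set.mem_ofPred_eq, h.coloring_edge]
    rfl
  have hval : (t.colorClass f k : Set ℕ) = Subtype.val '' {z : t.Edge | f z = k} := by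
    ext z
    simp only [mem_coe, mem_colorClass, Set.mem_image, Set.mem_ofPred_eq, Subtype.exists]
    grind
  rw [← Set.encard_coe_eq_coe_finsetCard, hedge, hval, h.bijective_edge.injective.encard_image,
    Subtype.val_injective.encard_image]

theorem IsRootingOf.largestGroup_coloring_le (h : t.IsRootingOf T) :
    largestGroup (h.coloring f) ≤ c ↔ ∀ k, #(t.colorClass f k) ≤ c := by
  simp only [largestGroup, iSup_le_iff, h.encard_coloring, Nat.cast_le]

theorem IsRootingOf.mem_colorsAt_coloring (h : t.IsRootingOf T) {v : Fin n} :
    k ∈ colorsAt (h.coloring f) v ↔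
      ((v : ℕ) ≠ t.root ∧ f v = k) ∨ ∃ w ∈ t.children v, f w = k := by
  simp only [colorsAt, h.bijective_edge.surjective.exists, h.mem_edge, h.coloring_edge,
    Set.mem_ofPred_eq, Subtype.exists, mem_children]
  grind

theorem IsSolution.isEdgeQColoring (hf : t.IsSolution c f) (h : t.IsRootingOf T) :
    IsEdgeQColoring 2 (h.coloring f) := by
  intro v
  obtain ⟨K, hK⟩ := hf.exists_color v v.2
  have hpair : ({K, f v} : Set ℕ).encard ≤ 2 :=
    (Set.encard_insert_le _ _).trans (by rw [Set.encard_singleton, one_add_one_eq_two])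
  refine (Set.encard_le_encard fun k hk => ?_).trans hpair
  rcases h.mem_colorsAt_coloring.1 hk with ⟨-, rfl⟩ | ⟨w, hw, rfl⟩
  exacts [.inr rfl, hK w hw]

theorem IsRootingOf.exists_isSolution (h : t.IsRootingOf T) {χ : T.EdgeLabeling ℕ}
    (hχ : IsEdgeQColoring 2 χ) (hc : largestGroup χ ≤ c) : ∃ f, t.IsSolution c f := by
  obtain ⟨p, hp⟩ : ∃ p, (colorsAt χ ⟨t.root, t.root_lt⟩).Nonempty →
      p ∈ colorsAt χ ⟨t.root, t.root_lt⟩ := by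
    rcases (colorsAt χ ⟨t.root, t.root_lt⟩).eq_empty_or_nonempty with h | ⟨p, hp⟩
    exacts [⟨0, fun h' => absurd h h'.ne_empty⟩, ⟨p, fun _ => hp⟩]
  obtain ⟨f, rfl, rfl⟩ := h.exists_coloring_eq χ p
  refine ⟨f, fun v hv => ?_, h.largestGroup_coloring_le.1 hc⟩
  have hchild : ∀ w ∈ t.children v, f w ∈ colorsAt (h.coloring f) ⟨v, hv⟩ := fun w hw =>
    h.mem_colorsAt_coloring.2 (.inr ⟨w, hw, rfl⟩)
  rcases (t.children v).eq_empty_or_nonempty with hempty | ⟨w₀, hw₀⟩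
  · exact ⟨0, by simp [hempty]⟩
  · have hmem : f v ∈ colorsAt (h.coloring f) ⟨v, hv⟩ := by
      by_cases hvr : v = t.root
      · subst hvr
        exact hp ⟨_, hchild w₀ hw₀⟩
      · exact h.mem_colorsAt_coloring.2 (.inl ⟨hvr, rfl⟩)
    obtain ⟨K, hK⟩ := exists_subset_pair (hχ _) hmem
    exact ⟨K, fun w hw => hK (hchild w hw)⟩

theorem IsRootingOf.get_coloring (h : t.IsRootingOf T) {m : ℕ → ℕ → ℕ} (hm : t.Represents m f)
    {x y : Fin n} (hxy : T.Adj x y) : (h.coloring f).get x y hxy = m x y := by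
  obtain ⟨z, hz, -⟩ := h.existsUnique_joins hxy
  rw [hm z z.2.1 z.2.2 x y hz, ← h.coloring_edge (f := f), (h.edge_eq_iff hxy).2 hz]
  rfl

end RootedTree

/-- There is a feasible solution all of whose color groups have size at most `c`. -/
def Solvable (T : SimpleGraph (Fin n)) (c : ℕ) : Prop :=
  ∃ χ : T.EdgeLabeling ℕ, IsEdgeQColoring 2 χ ∧ largestGroup χ ≤ c

theorem RootedTree.IsRootingOf.feasible_eq {t : RootedTree n} (h : t.IsRootingOf T) :
    t.Feasible = Solvable T :=
  funext fun _ => propext ⟨fun ⟨f, hf⟩ => ⟨h.coloring f, hf.isEdgeQColoring h,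
    h.largestGroup_coloring_le.2 hf.card_colorClass_le⟩,
    fun ⟨_, hχ, hc⟩ => h.exists_isSolution hχ hc⟩

theorem isRootable_input [DecidableRel T.Adj] (hT : T.IsTree) :
    IsRootable n ((input T).arr .adj) (Solvable T) := by
  intro r hr
  obtain ⟨t, ht, h⟩ := RootedTree.exists_isRootingOf hT ⟨r, hr⟩
  exact ⟨t, ht, RootedTree.isAdjMatrix_input_iff.2 h, h.feasible_eq⟩

theorem le_largestGroup (hc : c ∈ lowerBounds {c | Solvable T c}) {χ : T.EdgeLabeling ℕ}
    (hχ : IsEdgeQColoring 2 χ) : c ≤ largestGroup χ := by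
  cases h : largestGroup χ with
  | top => exact le_top
  | coe k => exact Nat.cast_le.2 (hc ⟨χ, hχ, h.le⟩)

theorem Outcome.exists_isOptimal [DecidableRel T.Adj] {σ : Memory Reg Arr}
    (h : Outcome n ((input T).arr .adj) (Solvable T) σ) :
    ∃ χ : T.EdgeLabeling ℕ, (∀ x y (hxy : T.Adj x y), χ.get x y hxy = σ.arr .M x y) ∧
      (∀ e, χ e ≠ 0) ∧ IsOptimal 2 χ ∧ largestGroup χ = σ.reg .m := by
  obtain ⟨t, ha, f, hf, hm, hf0⟩ := h.solution
  have ht := RootedTree.isAdjMatrix_input_iff.1 ha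
  have hcol := hf.isEdgeQColoring ht
  have hle := ht.largestGroup_coloring_le.2 hf.card_colorClass_le
  refine ⟨ht.coloring f, fun _ _ => ht.get_coloring hm, fun e => ?_,
    ⟨hcol, fun χ' hχ' => hle.trans (le_largestGroup h.isLeast.2 hχ')⟩,
    hle.antisymm (le_largestGroup h.isLeast.2 hcol)⟩
  obtain ⟨z, rfl⟩ := ht.bijective_edge.surjective e
  exact ht.coloring_edge z ▸ hf0 z z.2.1

end MinMaxColoring

theorem mainTheorem3 :
    ∃ p : Polynomial ℕ,
      ∀ (n : ℕ) (T : SimpleGraph (Fin n)) [DecidableRel T.Adj], T.IsTree →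
        ∃ (t : ℕ) (σ : MinMaxColoring.Memory MinMaxColoring.Reg MinMaxColoring.Arr),
          t ≤ p.eval n ∧
          MinMaxColoring.HaltsIn MinMaxColoring.treeColoring (MinMaxColoring.input T) t σ ∧
          ∃ χ : T.EdgeLabeling ℕ,
            (∀ (x y : Fin n) (h : T.Adj x y), χ.get x y h = σ.arr MinMaxColoring.Arr.M x y) ∧
            (∀ e : T.edgeSet, χ e ≠ 0) ∧
            MinMaxColoring.IsOptimal 2 χ ∧
            MinMaxColoring.largestGroup χ = (σ.reg MinMaxColoring.Reg.m : ℕ∞) := by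
  refine ⟨MinMaxColoring.timeBound MinMaxColoring.treeColoring, fun n T _ hT => ?_⟩
  obtain ⟨x⟩ := hT.connected.nonempty
  have hwp := MinMaxColoring.wp_treeColoring (σ := MinMaxColoring.input T)
    (MinMaxColoring.isRootable_input hT) x.pos le_rfl rfl
  obtain ⟨t, ht, σ, hrun, hout⟩ := hwp.haltsIn
  exact ⟨t, σ, ht, hrun, hout.exists_isOptimal⟩
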